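/- **Setting.** Fix a propositional language $\mathcal L$ (connectives of finite arity, a set of atomic formulas, possibly with a unary connective $\Box$) in which the connectives $\wedge,\vee,\to,*,+,0,1,\top,\bot$ are available, either as connectives of $\mathcal L$ or through a translation sending each of them to a formula of $\mathcal L$ in which every argument occurs at most once. $V(A)$ is the set of atoms (and formula symbols) of $A$; $A$ is $p$-free if $p\notin V(A)$. A sequent is $\Gamma\Rightarrow\Delta$ with $\Gamma,\Delta$ finite multisets of formulas, and $(\Gamma\Rightarrow\Delta)\cdot(\Gamma'\Rightarrow\Delta')=(\Gamma,\Gamma'\Rightarrow\Delta,\Delta')$. Meta-formulas are built from atoms and formula symbols. A rule has finitely many meta-sequents (multisets of meta-formulas and meta-multiset variables on both sides) as premises and one as conclusion; its instances arise by substituting formulas for formula symbols and multisets for meta-multiset variables. A calculus is a set of rules. $\mathbf{CFL_e}$ is the multi-conclusion calculus with the axioms $\phi\Rightarrow\phi$; $\;\Gamma\Rightarrow\top,\Delta$; $\;\Gamma,\bot\Rightarrow\Delta$; $\;\Rightarrow 1$; $\;0\Rightarrow$, and the usual multi-conclusion rules: from $\Gamma\Rightarrow\Delta$ infer $\Gamma,1\Rightarrow\Delta$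 and $\Gamma\Rightarrow 0,\Delta$; the context-sharing rules for $\wedge$ (left: from $\Gamma,\phi\Rightarrow\Delta$ or from $\Gamma,\psi\Rightarrow\Delta$ infer $\Gamma,\phi\wedge\psi\Rightarrow\Delta$; right: two premises) and, dually, for $\vee$; from $\Gamma,\phi,\psi\Rightarrow\Delta$ infer $\Gamma,\phi*\psi\Rightarrow\Delta$; from $\Gamma\Rightarrow\phi,\Delta$ and $\Sigma\Rightarrow\psi,\Lambda$ infer $\Gamma,\Sigma\Rightarrow\phi*\psi,\Delta,\Lambda$; from $\Gamma\Rightarrow\phi,\Delta$ and $\Sigma,\psi\Rightarrow\Lambda$ infer $\Gamma,\Sigma,\phi\to\psi\Rightarrow\Delta,\Lambda$; from $\Gamma,\phi\Rightarrow\psi,\Delta$ infer $\Gamma\Rightarrow\phi\to\psi,\Delta$; from $\Gamma,\phi\Rightarrow\Delta$ and $\Sigma,\psi\Rightarrow\Lambda$ infer $\Gamma,\Sigma,\phi+\psi\Rightarrow\Delta,\Lambda$; from $\Gamma\Rightarrow\phi,\psi,\Delta$ infer $\Gamma\Rightarrow\phi+\psi,\Delta$. A logic $L$ is a set of formulas (its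 theorems, $L\vdash A$) closed under modus ponens (for $\to$) and adjunction (from $A$ and $B$ infer $A\wedge B$). $L$ extends $\mathbf{CFL_e}$ if $L\vdash A$ whenever $\mathbf{CFL_e}$ proves $\Rightarrow A$. A calculus $H$ is a calculus for $L$ if, for all $\Gamma,\Delta$, $H\vdash\Gamma\Rightarrow\Delta$ iff $L\vdash \mathop{\ast}\Gamma\to\mathop{+}\Delta$ (the empty fusion is $1$, the empty sum is $0$). $H$ is *terminating* if every sequent $S$ is the conclusion of only finitely many rule instances of $H$, and there is a well-founded order on sequents in which the following are smaller than $S$: the premises of every rule instance of $H$ with conclusion $S$; the proper subsequents of $S$; and every $(\Gamma,\Pi\Rightarrow\Delta,\Lambda)$ with $\Pi\cup\Lambda\ne\emptyset$ and $S=(\Gamma,\Box\Pi\Rightarrow\Delta,\Box\Lambda)$. *Focused axioms* are the axioms of the forms $\phi\Rightarrow\phi$; $\;\Rightarrow\bar\alpha$; $\;\bar\beta\Rightarrow$; $\;\Gamma,\bar\phi\Rightarrow\Delta$; $\;\Gamma\Rightarrow\bar\phi,\Delta$, where $\Gamma,\Delta$ are distinct meta-multiset variables, $\phi$ is a meta-formula,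 and $\bar\alpha$, $\bar\beta$, $\bar\phi$ are multisets of meta-formulas within each of which any two members have the same variables $V$. *Multi-conclusion semi-analytic rules* are the rules with premises $\langle\langle \Gamma_i,\bar\phi_{ir}\Rightarrow\bar\psi_{ir},\Delta_i\rangle_r\rangle_i$ and conclusion $\Gamma_1,\dots,\Gamma_n,\phi\Rightarrow\Delta_1,\dots,\Delta_n$ (left) or $\Gamma_1,\dots,\Gamma_n\Rightarrow\phi,\Delta_1,\dots,\Delta_n$ (right), where the $\Gamma_i,\Delta_i$ are pairwise distinct meta-multiset variables and $\bigcup_{i,r}\big(V(\bar\phi_{ir})\cup V(\bar\psi_{ir})\big)\subseteq V(\phi)$; and the modal rules $(K)$: from $\Gamma\Rightarrow\phi$ infer $\Box\Gamma\Rightarrow\Box\phi$, and $(D)$: from $\Gamma\Rightarrow$ infer $\Box\Gamma\Rightarrow$ (with $\Gamma\neq\emptyset$). A calculus containing $(D)$ is required to contain $(K)$. **Statement.** Let $L$ be a logic extending $\mathbf{CFL_e}$, and let $H$ be a terminating multi-conclusion sequent calculus for $L$ consisting of focused axioms and multi-conclusion semi-analytic rules. Then $L$ has uniform interpolation: for every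 formula $\phi$ and atom $p$ there are $p$-free formulas $\forall p\,\phi$ and $\exists p\,\phi$ such that 1. $L\vdash\forall p\,\phi\to\phi$, and for every $p$-free $\psi$, if $L\vdash\psi\to\phi$ then $L\vdash\psi\to\forall p\,\phi$; 2. $L\vdash\phi\to\exists p\,\phi$, and for every $p$-free $\psi$, if $L\vdash\phi\to\psi$ then $L\vdash\exists p\,\phi\to\psi$. Moreover, $H$ has strong $H$-uniform interpolation: for every sequent $S$ and atom $p$ there are $p$-free formulas $I,J$ such that $S\cdot(I\Rightarrow)$ and $S\cdot(\Rightarrow J)$ are derivable in $H$ and, for all $p$-free multisets $\Gamma,\Delta$, if $S\cdot(\Gamma\Rightarrow\Delta)$ is derivable in $H$, then so are $\Gamma\Rightarrow I,\Delta$ and $J,\Gamma\Rightarrow\Delta$. -/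

import Mathlib

universe u v w

namespace SeqCalc

/-! ### Languages and formulas -/

/-- A set of logical connectives with their finite arities. -/
structure Signature where
  Conn : Type u
  arity : Conn → ℕ

/-- Formulas over a signature, built from variables in `α`. -/
inductive Form (Sg : Signature.{u}) (α : Type v) : Type (max u v)
  | var : α → Form Sg α
  | app : (c : Sg.Conn) → (Fin (Sg.arity c) → Form Sg α) → Form Sg α

/-- `V(A)`: the variables that occur in `A`. -/
def Form.vars {Sg : Signature.{u}} {α : Type v} : Form Sg α → Set α
  | .var a => {a}
  | .app _ args => ⋃ i, (args i).vars

/-- Simultaneous substitution. -/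
def Form.subst {Sg : Signature.{u}} {α : Type v} {β : Type w} (f : α → Form Sg β) :
    Form Sg α → Form Sg β
  | .var a => f a
  | .app c args => .app c (fun i => (args i).subst f)

/-- The number of occurrences of the variable `a`. -/
def Form.occ {Sg : Signature.{u}} {α : Type v} [DecidableEq α] (a : α) : Form Sg α → ℕ
  | .var b => if b = a then 1 else 0
  | .app _ args => ∑ i, (args i).occ a

/-- A formula `φ_C(p_1, …, p_n)` that may serve as the translation of an `n`-ary connective:
every `p_i` has at most one occurrence in it. -/
structure Derived (Sg : Signature.{u}) (n : ℕ) where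
  body : Form Sg (Fin n)
  linear : ∀ i, body.occ i ≤ 1

/-- An arbitrary propositional language.  The basic connectives are given by a translation into
the language; a connective `c` that belongs to the language is translated by itself, as
`c(p_1, …, p_n)`.  The modality `□` may or may not belong to the language. -/
structure Language extends Signature.{u} where
  conj : Derived toSignature 2
  disj : Derived toSignature 2
  imp : Derived toSignature 2
  fus : Derived toSignature 2
  plus : Derived toSignature 2
  zero : Derived toSignature 0
  one : Derived toSignature 0
  top : Derived toSignature 0
  bot : Derived toSignature 0
  box : Option {c : Conn // arity c = 1}

namespace Language

variable (Lg : Language.{u}) {α : Type v}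

/-- `A ∧ B` -/
def cConj (A B : Form Lg.toSignature α) : Form Lg.toSignature α := Lg.conj.body.subst ![A, B]
/-- `A ∨ B` -/
def cDisj (A B : Form Lg.toSignature α) : Form Lg.toSignature α := Lg.disj.body.subst ![A, B]
/-- `A → B` -/
def cImp (A B : Form Lg.toSignature α) : Form Lg.toSignature α := Lg.imp.body.subst ![A, B]
/-- `A * B` -/
def cFus (A B : Form Lg.toSignature α) : Form Lg.toSignature α := Lg.fus.body.subst ![A, B]
/-- `A + B` -/
def cPlus (A B : Form Lg.toSignature α) : Form Lg.toSignature α := Lg.plus.body.subst ![A, B]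
/-- `0` -/
def cZero : Form Lg.toSignature α := Lg.zero.body.subst ![]
/-- `1` -/
def cOne : Form Lg.toSignature α := Lg.one.body.subst ![]
/-- `⊤` -/
def cTop : Form Lg.toSignature α := Lg.top.body.subst ![]
/-- `⊥` -/
def cBot : Form Lg.toSignature α := Lg.bot.body.subst ![]
/-- `□A`, for a unary connective `b` -/
def cBox (b : {c : Lg.Conn // Lg.arity c = 1}) (A : Form Lg.toSignature α) :
    Form Lg.toSignature α := .app b.1 (fun _ => A)

/-- The fusion of a finite family; the empty fusion is `1`. -/
def bigFus : List (Form Lg.toSignature α) → Form Lg.toSignature α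
  | [] => Lg.cOne
  | [A] => A
  | A :: B :: l => Lg.cFus A (bigFus (B :: l))

/-- The sum of a finite family; the empty sum is `0`. -/
def bigPlus : List (Form Lg.toSignature α) → Form Lg.toSignature α
  | [] => Lg.cZero
  | [A] => A
  | A :: B :: l => Lg.cPlus A (bigPlus (B :: l))

end Language

/-- The formulas of the language over the atomic formulas `At`. -/
abbrev Formula (Lg : Language.{u}) (At : Type v) := Form Lg.toSignature At

/-- `A` is `p`-free. -/
def PFree {Lg : Language.{u}} {At : Type v} (p : At) (A : Formula Lg At) : Prop := p ∉ A.vars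

/-- Every formula of the multiset is `p`-free. -/
def MPFree {Lg : Language.{u}} {At : Type v} (p : At) (Γ : Multiset (Formula Lg At)) : Prop :=
  ∀ A ∈ Γ, PFree p A

/-! ### Sequents, rules and calculi -/

/-- A (multi-conclusion) sequent `ant ⇒ suc`. -/
@[ext]
structure Sequent (Lg : Language.{u}) (At : Type v) where
  ant : Multiset (Formula Lg At)
  suc : Multiset (Formula Lg At)

/-- `S · T` -/
def Sequent.mul {Lg : Language.{u}} {At : Type v} (S T : Sequent Lg At) : Sequent Lg At :=
  ⟨S.ant + T.ant, S.suc + T.suc⟩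

/-- `S` is a proper subsequent of `T`. -/
def Sequent.ProperSub {Lg : Language.{u}} {At : Type v} (S T : Sequent Lg At) : Prop :=
  S.ant ≤ T.ant ∧ S.suc ≤ T.suc ∧ S ≠ T

/-- Meta-formulas, built from atomic formulas (left) and formula symbols (right). -/
abbrev MetaFormula (Lg : Language.{u}) (At : Type v) := Form Lg.toSignature (At ⊕ ℕ)

/-- A multiset of meta-formulas and meta-multiset variables (contexts), the latter named by
natural numbers. -/
structure MetaMultiset (Lg : Language.{u}) (At : Type v) where
  forms : Multiset (MetaFormula Lg At)
  ctxs : Multiset ℕ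

/-- A meta-sequent. -/
structure MetaSequent (Lg : Language.{u}) (At : Type v) where
  ant : MetaMultiset Lg At
  suc : MetaMultiset Lg At

/-- Substituting formulas for the formula symbols of a meta-formula. -/
def MetaFormula.inst {Lg : Language.{u}} {At : Type v} (σ : ℕ → Formula Lg At)
    (A : MetaFormula Lg At) : Formula Lg At :=
  Form.subst (Sum.elim Form.var σ) A

/-- Substituting formulas for formula symbols and multisets for contexts. -/
def MetaMultiset.inst {Lg : Language.{u}} {At : Type v} (σ : ℕ → Formula Lg At)
    (τ : ℕ → Multiset (Formula Lg At)) (M : MetaMultiset Lg At) : Multiset (Formula Lg At) :=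
  M.forms.map (MetaFormula.inst σ) + M.ctxs.bind τ

/-- Substitution in a meta-sequent. -/
def MetaSequent.inst {Lg : Language.{u}} {At : Type v} (σ : ℕ → Formula Lg At)
    (τ : ℕ → Multiset (Formula Lg At)) (S : MetaSequent Lg At) : Sequent Lg At :=
  ⟨S.ant.inst σ τ, S.suc.inst σ τ⟩

/-- A rule: finitely many meta-sequents as premises and a meta-sequent as conclusion, or one of
the two modal rules `K` (from `Γ ⇒ φ` infer `□Γ ⇒ □φ`) and `D` (from `Γ ⇒` infer `□Γ ⇒`), whose
conclusions contain the boxed context `□Γ`. -/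
inductive Rule (Lg : Language.{u}) (At : Type v) : Type (max u v)
  | schematic (prems : Multiset (MetaSequent Lg At)) (concl : MetaSequent Lg At)
  | modalK
  | modalD

/-- `R.Inst P S`: the inference from the premises `P` to the conclusion `S` is an instance of `R`.
In `D` the context is nonempty: its instance with the empty context would be the idle step
from the empty sequent to itself. -/
def Rule.Inst {Lg : Language.{u}} {At : Type v} (R : Rule Lg At)
    (P : Multiset (Sequent Lg At)) (S : Sequent Lg At) : Prop :=
  match R with
  | .schematic prems concl => ∃ (σ : ℕ → Formula Lg At) (τ : ℕ → Multiset (Formula Lg At)),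
      P = prems.map (MetaSequent.inst σ τ) ∧ S = concl.inst σ τ
  | .modalK => ∃ b, Lg.box = some b ∧ ∃ (Γ : Multiset (Formula Lg At)) (A : Formula Lg At),
      P = {⟨Γ, {A}⟩} ∧ S = ⟨Γ.map (Lg.cBox b), {Lg.cBox b A}⟩
  | .modalD => ∃ b, Lg.box = some b ∧ ∃ Γ : Multiset (Formula Lg At), Γ ≠ 0 ∧
      P = {⟨Γ, 0⟩} ∧ S = ⟨Γ.map (Lg.cBox b), 0⟩

/-- A sequent calculus is a set of rules. -/
abbrev Calculus (Lg : Language.{u}) (At : Type v) := Set (Rule Lg At)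

/-- `G ⊢ S`: there is a proof tree of `S` in `G`. -/
inductive Derivable {Lg : Language.{u}} {At : Type v} (G : Calculus Lg At) :
    Sequent Lg At → Prop
  | step (R : Rule Lg At) (P : Multiset (Sequent Lg At)) (S : Sequent Lg At)
      (hR : R ∈ G) (hI : R.Inst P S) (hP : ∀ T ∈ P, Derivable G T) : Derivable G S

/-- Terminating calculi.  A relation that is well-founded may be replaced by its transitive
closure, so it does not matter that transitivity is not required. -/
def Terminating {Lg : Language.{u}} {At : Type v} (G : Calculus Lg At) : Prop :=
  (∀ S : Sequent Lg At, {P : Multiset (Sequent Lg At) | ∃ R ∈ G, R.Inst P S}.Finite) ∧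
  ∃ lt : Sequent Lg At → Sequent Lg At → Prop, WellFounded lt ∧
    (∀ R ∈ G, ∀ P S, R.Inst P S → ∀ T ∈ P, lt T S) ∧
    (∀ S T : Sequent Lg At, T.ProperSub S → lt T S) ∧
    (∀ b, Lg.box = some b → ∀ Γ Θ Δ Λ : Multiset (Formula Lg At), Θ + Λ ≠ 0 →
      lt ⟨Γ + Θ, Δ + Λ⟩ ⟨Γ + Θ.map (Lg.cBox b), Δ + Λ.map (Lg.cBox b)⟩)

/-! ### The calculus `CFL_e` -/

section CFLe

variable (Lg : Language.{u}) (At : Type v)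

/-- The meta-sequent with formulas `f`, `g` and contexts `c`, `d` on the left and right. -/
def mseq {Lg : Language.{u}} {At : Type v} (f : Multiset (MetaFormula Lg At)) (c : Multiset ℕ)
    (g : Multiset (MetaFormula Lg At)) (d : Multiset ℕ) : MetaSequent Lg At :=
  ⟨⟨f, c⟩, ⟨g, d⟩⟩

/-- The multi-conclusion calculus `CFL_e`, written in the language `Lg`.  The contexts
`Γ, Δ, Σ, Λ` are `0, 1, 2, 3` and the formula symbols `φ, ψ` are `0, 1`. -/
def CFLe : Calculus Lg At :=
  let φ : MetaFormula Lg At := .var (.inr 0)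
  let ψ : MetaFormula Lg At := .var (.inr 1)
  { -- identity
    .schematic 0 (mseq {φ} 0 {φ} 0),
    -- contextual axioms for top and bottom
    .schematic 0 (mseq 0 {0} {Lg.cTop} {1}),
    .schematic 0 (mseq {Lg.cBot} {0} 0 {1}),
    -- context-free axioms for one and zero
    .schematic 0 (mseq 0 0 {Lg.cOne} 0),
    .schematic 0 (mseq {Lg.cZero} 0 0 0),
    -- rules for one and zero
    .schematic {mseq 0 {0} 0 {1}} (mseq {Lg.cOne} {0} 0 {1}),
    .schematic {mseq 0 {0} 0 {1}} (mseq 0 {0} {Lg.cZero} {1}),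
    -- conjunction
    .schematic {mseq {φ} {0} 0 {1}} (mseq {Lg.cConj φ ψ} {0} 0 {1}),
    .schematic {mseq {ψ} {0} 0 {1}} (mseq {Lg.cConj φ ψ} {0} 0 {1}),
    .schematic {mseq 0 {0} {φ} {1}, mseq 0 {0} {ψ} {1}} (mseq 0 {0} {Lg.cConj φ ψ} {1}),
    -- disjunction
    .schematic {mseq {φ} {0} 0 {1}, mseq {ψ} {0} 0 {1}} (mseq {Lg.cDisj φ ψ} {0} 0 {1}),
    .schematic {mseq 0 {0} {φ} {1}} (mseq 0 {0} {Lg.cDisj φ ψ} {1}),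
    .schematic {mseq 0 {0} {ψ} {1}} (mseq 0 {0} {Lg.cDisj φ ψ} {1}),
    -- fusion
    .schematic {mseq {φ, ψ} {0} 0 {1}} (mseq {Lg.cFus φ ψ} {0} 0 {1}),
    .schematic {mseq 0 {0} {φ} {1}, mseq 0 {2} {ψ} {3}} (mseq 0 {0, 2} {Lg.cFus φ ψ} {1, 3}),
    -- implication
    .schematic {mseq 0 {0} {φ} {1}, mseq {ψ} {2} 0 {3}} (mseq {Lg.cImp φ ψ} {0, 2} 0 {1, 3}),
    .schematic {mseq {φ} {0} {ψ} {1}} (mseq 0 {0} {Lg.cImp φ ψ} {1}),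
    -- addition
    .schematic {mseq {φ} {0} 0 {1}, mseq {ψ} {2} 0 {3}} (mseq {Lg.cPlus φ ψ} {0, 2} 0 {1, 3}),
    .schematic {mseq 0 {0} {φ, ψ} {1}} (mseq 0 {0} {Lg.cPlus φ ψ} {1}) }

end CFLe

/-! ### Focused axioms and multi-conclusion semi-analytic rules -/

/-- Any two elements have the same variables. -/
def SameVars {Lg : Language.{u}} {At : Type v} (M : Multiset (MetaFormula Lg At)) : Prop :=
  ∀ A ∈ M, ∀ B ∈ M, A.vars = B.vars

/-- Focused axioms, as rules without premises. -/
inductive IsFocusedAxiom {Lg : Language.{u}} {At : Type v} : Rule Lg At → Prop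
  | identity (φ : MetaFormula Lg At) : IsFocusedAxiom (.schematic 0 (mseq {φ} 0 {φ} 0))
  | freeRight (α : Multiset (MetaFormula Lg At)) (h : SameVars α) :
      IsFocusedAxiom (.schematic 0 (mseq 0 0 α 0))
  | freeLeft (β : Multiset (MetaFormula Lg At)) (h : SameVars β) :
      IsFocusedAxiom (.schematic 0 (mseq β 0 0 0))
  | ctxLeft (φ : Multiset (MetaFormula Lg At)) (Γ Δ : ℕ) (hc : Γ ≠ Δ) (h : SameVars φ) :
      IsFocusedAxiom (.schematic 0 (mseq φ {Γ} 0 {Δ}))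
  | ctxRight (φ : Multiset (MetaFormula Lg At)) (Γ Δ : ℕ) (hc : Γ ≠ Δ) (h : SameVars φ) :
      IsFocusedAxiom (.schematic 0 (mseq 0 {Γ} φ {Δ}))

/-- The premises and contexts of a multi-conclusion semi-analytic rule with main formula `main`:
the premises are `Γ_i, φ̄_{ir} ⇒ ψ̄_{ir}, Δ_i` for `i < n` and `r < m i`, where the contexts `Γ_i`,
`Δ_i` are pairwise distinct meta-multiset variables and all variables of the `φ̄_{ir}`, `ψ̄_{ir}`
occur in the main formula. -/
structure SemiAnalyticData (Lg : Language.{u}) (At : Type v) where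
  main : MetaFormula Lg At
  n : ℕ
  m : Fin n → ℕ
  Γ : Fin n → ℕ
  Δ : Fin n → ℕ
  distinct : Function.Injective (Sum.elim Γ Δ)
  φ : (i : Fin n) → Fin (m i) → Multiset (MetaFormula Lg At)
  ψ : (i : Fin n) → Fin (m i) → Multiset (MetaFormula Lg At)
  occurrence : ∀ i r, ∀ A ∈ φ i r + ψ i r, A.vars ⊆ main.vars

namespace SemiAnalyticData

variable {Lg : Language.{u}} {At : Type v} (d : SemiAnalyticData Lg At)

/-- `⟨⟨Γ_i, φ̄_{ir} ⇒ ψ̄_{ir}, Δ_i⟩_r⟩_i` -/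
def prems : Multiset (MetaSequent Lg At) :=
  (Finset.univ : Finset (Σ i : Fin d.n, Fin (d.m i))).val.map
    (fun x => mseq (d.φ x.1 x.2) {d.Γ x.1} (d.ψ x.1 x.2) {d.Δ x.1})

/-- `Γ_1, …, Γ_n` -/
def leftCtxs : Multiset ℕ := (Finset.univ : Finset (Fin d.n)).val.map d.Γ

/-- `Δ_1, …, Δ_n` -/
def rightCtxs : Multiset ℕ := (Finset.univ : Finset (Fin d.n)).val.map d.Δ

/-- The left rule, with conclusion `Γ_1, …, Γ_n, φ ⇒ Δ_1, …, Δ_n`. -/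
def leftRule : Rule Lg At := .schematic d.prems (mseq {d.main} d.leftCtxs 0 d.rightCtxs)

/-- The right rule, with conclusion `Γ_1, …, Γ_n ⇒ φ, Δ_1, …, Δ_n`. -/
def rightRule : Rule Lg At := .schematic d.prems (mseq 0 d.leftCtxs {d.main} d.rightCtxs)

end SemiAnalyticData

/-- Multi-conclusion semi-analytic rules: left, right, or modal. -/
def IsSemiAnalytic {Lg : Language.{u}} {At : Type v} (R : Rule Lg At) : Prop :=
  (∃ d : SemiAnalyticData Lg At, R = d.leftRule) ∨
  (∃ d : SemiAnalyticData Lg At, R = d.rightRule) ∨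
  R = .modalK ∨ R = .modalD

/-- `G` consists of focused axioms and multi-conclusion semi-analytic rules; whenever the rule `D`
is present, so is `K`. -/
def ConsistsOfSemiAnalytic {Lg : Language.{u}} {At : Type v} (G : Calculus Lg At) : Prop :=
  (∀ R ∈ G, IsFocusedAxiom R ∨ IsSemiAnalytic R) ∧ (.modalD ∈ G → .modalK ∈ G)

/-! ### Logics and uniform interpolation -/

/-- A logic: a set of formulas (the theorems) closed under modus ponens and adjunction. -/
structure Logic (Lg : Language.{u}) (At : Type v) where
  thms : Set (Formula Lg At)
  mp : ∀ A B, Lg.cImp A B ∈ thms → A ∈ thms → B ∈ thms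
  adj : ∀ A B, A ∈ thms → B ∈ thms → Lg.cConj A B ∈ thms

/-- `L` extends `CFL_e`. -/
def Logic.ExtendsCFLe {Lg : Language.{u}} {At : Type v} (L : Logic Lg At) : Prop :=
  ∀ A : Formula Lg At, Derivable (CFLe Lg At) ⟨0, {A}⟩ → A ∈ L.thms

/-- `G` is a sequent calculus for `L`: `G ⊢ Γ ⇒ Δ` iff `L ⊢ ∗Γ → +Δ`.  Here `Γ` and `Δ` are given
by arbitrary enumerations of the multisets. -/
def IsCalculusFor {Lg : Language.{u}} {At : Type v} (G : Calculus Lg At) (L : Logic Lg At) :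
    Prop :=
  ∀ Γ Δ : List (Formula Lg At),
    Derivable G ⟨(Γ : Multiset (Formula Lg At)), (Δ : Multiset (Formula Lg At))⟩ ↔
      Lg.cImp (Lg.bigFus Γ) (Lg.bigPlus Δ) ∈ L.thms

/-- The uniform interpolation property of a logic. -/
def Logic.UniformInterpolation {Lg : Language.{u}} {At : Type v} (L : Logic Lg At) : Prop :=
  ∀ (A : Formula Lg At) (p : At), ∃ pre post : Formula Lg At, PFree p pre ∧ PFree p post ∧
    Lg.cImp pre A ∈ L.thms ∧
    (∀ B, PFree p B → Lg.cImp B A ∈ L.thms → Lg.cImp B pre ∈ L.thms) ∧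
    Lg.cImp A post ∈ L.thms ∧
    (∀ B, PFree p B → Lg.cImp A B ∈ L.thms → Lg.cImp post B ∈ L.thms)

/-- `G` has strong `H`-uniform interpolation. -/
def StrongUniformInterpolation {Lg : Language.{u}} {At : Type v} (G H : Calculus Lg At) : Prop :=
  ∀ (S : Sequent Lg At) (p : At), ∃ I J : Formula Lg At, PFree p I ∧ PFree p J ∧
    Derivable H (S.mul ⟨{I}, 0⟩) ∧
    (∀ Γ Δ, MPFree p Γ → MPFree p Δ →
      Derivable G (S.mul ⟨Γ, Δ⟩) → Derivable H ⟨Γ, {I} + Δ⟩) ∧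
    Derivable H (S.mul ⟨0, {J}⟩) ∧
    (∀ Γ Δ, MPFree p Γ → MPFree p Δ →
      Derivable G (S.mul ⟨Γ, Δ⟩) → Derivable H ⟨{J} + Γ, Δ⟩)

end SeqCalc

/-! Since `H` is a calculus for an extension of CFL_e, derivability in `H` is closed under every
rule of CFL_e, although `H` need not contain these rules; no cut is needed. With `I` a left
interpolant of `S`, the formula `I → 0` serves as the right one, so only `I` has to be built.

`I` is found by well-founded induction along the termination order. A `p`-free sequent is its own
interpolant, read as the formula `∗Γ → +Δ`. For any other `S`, `I` is a finite disjunction of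
`p`-free formulas `F` with `S·(F ⇒)` derivable. It must be rich enough for every derivable `S·X`
with `X` `p`-free, and this is checked by the last rule of the derivation.

In a focused axiom, all focused formulas have the same variables, so those in `S` and those in `X`
cannot disagree about `p`. If the main formula lies in `S`, splitting every context between `S` and
`X` leaves a rule instance with conclusion `S`; the interpolants of its premises are joined by `∧`
along a shared context and by `∗` across contexts (`exists_finite_of_main_left`). If it lies in `X`,
the active formulas are `p`-free by the occurrence condition: either `S` falls into one context, and
the induction over the derivation carries `I` through the rule, or `S` breaks into proper
subsequents whose interpolants are summed (`exists_finite_of_main_right`). For modal rules the box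
is stripped from `S`, and the interpolant is boxed or, dually, becomes `□(I → 0) → 0`.

The disjuncts must come from a finite set fixed before `X`; termination and bounds on the numbers of
nontrivial factors and summands supply it. -/

namespace SeqCalc

/-! ### Formulas: substitution and variables -/

section Formulas

variable {Sg : Signature.{u}} {α : Type v} {β : Type w}

theorem Form.vars_subst (f : α → Form Sg β) (A : Form Sg α) :
    (A.subst f).vars = ⋃ a ∈ A.vars, (f a).vars := by
  induction A with
  | var a => simp [Form.subst, Form.vars]
  | app c args ih =>
    ext x
    simp only [Form.subst, Form.vars, ih, Set.mem_iUnion, exists_prop]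
    constructor
    · rintro ⟨i, a, ha, hx⟩
      exact ⟨a, ⟨i, ha⟩, hx⟩
    · rintro ⟨a, ⟨i, ha⟩, hx⟩
      exact ⟨i, a, ha, hx⟩

theorem Form.subst_subst {γ : Type*} (f : α → Form Sg β) (g : β → Form Sg γ) (A : Form Sg α) :
    (A.subst f).subst g = A.subst (fun a => (f a).subst g) := by
  induction A with
  | var a => rfl
  | app c args ih => simp only [Form.subst, ih]

end Formulas

/-! ### Defined connectives and `p`-freeness -/

section Connectives

variable {Lg : Language.{u}} {α : Type v}

theorem Derived.subst_subst₂ {Sg : Signature.{u}} {β : Type w} (t : Derived Sg 2)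
    (f : α → Form Sg β) (A B : Form Sg α) :
    (t.body.subst ![A, B]).subst f = t.body.subst ![A.subst f, B.subst f] := by
  rw [Form.subst_subst]
  congr 1
  funext i
  fin_cases i <;> rfl

theorem Derived.subst_subst₀ {Sg : Signature.{u}} {β : Type w} (t : Derived Sg 0)
    (f : α → Form Sg β) : (t.body.subst ![]).subst f = t.body.subst ![] := by
  rw [Form.subst_subst]
  congr 1
  funext i
  exact i.elim0

theorem Derived.pFree₂ {At : Type v} {p : At} (t : Derived Lg.toSignature 2) {A B : Formula Lg At}
    (hA : PFree p A) (hB : PFree p B) : PFree p (t.body.subst ![A, B]) := by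
  simp only [PFree, Form.vars_subst, Set.mem_iUnion, not_exists]
  intro i _
  fin_cases i
  · exact hA
  · exact hB

theorem Derived.pFree₀ {At : Type v} {p : At} (t : Derived Lg.toSignature 0) :
    PFree (Lg := Lg) p (t.body.subst ![]) := by
  simp only [PFree, Form.vars_subst, Set.mem_iUnion, not_exists]
  intro i
  exact i.elim0

variable {At : Type v} {p : At}

theorem pFree_cBox (b : {c : Lg.Conn // Lg.arity c = 1}) {A : Formula Lg At} :
    PFree p (Lg.cBox b A) ↔ PFree p A := by
  -- Arity one guarantees that the argument occurs, so the union of variables is not empty by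
  -- default.
  have : Nonempty (Fin (Lg.arity b.1)) := ⟨⟨0, by simp [b.2]⟩⟩
  simp [PFree, Language.cBox, Form.vars]

theorem cBox_injective (b : {c : Lg.Conn // Lg.arity c = 1}) :
    Function.Injective (Lg.cBox b : Formula Lg At → Formula Lg At) := by
  intro A B h
  simp only [Language.cBox, Form.app.injEq, heq_eq_eq, true_and] at h
  exact congrFun h ⟨0, by simp [b.2]⟩

theorem pFree_bigFus {l : List (Formula Lg At)} (h : ∀ A ∈ l, PFree p A) :
    PFree p (Lg.bigFus l) := by
  induction l using Language.bigFus.induct with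
  | case1 => exact Lg.one.pFree₀
  | case2 A => exact h A (by simp)
  | case3 A B l ih => exact Lg.fus.pFree₂ (h A (by simp)) (ih fun C hC => h C (by simp [hC]))

theorem pFree_bigPlus {l : List (Formula Lg At)} (h : ∀ A ∈ l, PFree p A) :
    PFree p (Lg.bigPlus l) := by
  induction l using Language.bigPlus.induct with
  | case1 => exact Lg.zero.pFree₀
  | case2 A => exact h A (by simp)
  | case3 A B l ih => exact Lg.plus.pFree₂ (h A (by simp)) (ih fun C hC => h C (by simp [hC]))

/-- The conjunction of a finite family; the empty conjunction is `⊤`. -/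
def Language.bigConj (Lg : Language.{u}) : List (Form Lg.toSignature α) → Form Lg.toSignature α :=
  List.foldr Lg.cConj Lg.cTop

/-- The disjunction of a finite family; the empty disjunction is `⊥`. -/
def Language.bigDisj (Lg : Language.{u}) : List (Form Lg.toSignature α) → Form Lg.toSignature α :=
  List.foldr Lg.cDisj Lg.cBot

theorem pFree_bigConj {l : List (Formula Lg At)} (h : ∀ A ∈ l, PFree p A) :
    PFree p (Lg.bigConj l) := by
  induction l with
  | nil => exact Lg.top.pFree₀
  | cons A l ih => exact Lg.conj.pFree₂ (h A (by simp)) (ih fun C hC => h C (by simp [hC]))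

theorem pFree_bigDisj {l : List (Formula Lg At)} (h : ∀ A ∈ l, PFree p A) :
    PFree p (Lg.bigDisj l) := by
  induction l with
  | nil => exact Lg.bot.pFree₀
  | cons A l ih => exact Lg.disj.pFree₂ (h A (by simp)) (ih fun C hC => h C (by simp [hC]))

end Connectives

/-! ### The monoid of sequents -/

namespace Sequent

variable {Lg : Language.{u}} {At : Type v}

instance : Add (Sequent Lg At) := ⟨Sequent.mul⟩

instance : Zero (Sequent Lg At) := ⟨⟨0, 0⟩⟩

instance : AddCommMonoid (Sequent Lg At) where
  add_assoc S T U := Sequent.ext (add_assoc _ _ _) (add_assoc _ _ _)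
  zero_add S := Sequent.ext (zero_add _) (zero_add _)
  add_zero S := Sequent.ext (add_zero _) (add_zero _)
  add_comm S T := Sequent.ext (add_comm _ _) (add_comm _ _)
  nsmul := nsmulRec

@[simp] theorem ant_add (S T : Sequent Lg At) : (S + T).ant = S.ant + T.ant := rfl
@[simp] theorem suc_add (S T : Sequent Lg At) : (S + T).suc = S.suc + T.suc := rfl
@[simp] theorem ant_zero : (0 : Sequent Lg At).ant = 0 := rfl
@[simp] theorem suc_zero : (0 : Sequent Lg At).suc = 0 := rfl

theorem add_def (S T : Sequent Lg At) : S + T = ⟨S.ant + T.ant, S.suc + T.suc⟩ := rfl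

theorem mk_add_mk (a b c d : Multiset (Formula Lg At)) :
    (⟨a, b⟩ + ⟨c, d⟩ : Sequent Lg At) = ⟨a + c, b + d⟩ := rfl

/-- The antecedent, as a homomorphism. -/
def antHom : Sequent Lg At →+ Multiset (Formula Lg At) := ⟨⟨ant, rfl⟩, fun _ _ => rfl⟩

/-- The succedent, as a homomorphism. -/
def sucHom : Sequent Lg At →+ Multiset (Formula Lg At) := ⟨⟨suc, rfl⟩, fun _ _ => rfl⟩

theorem ant_sum {ι : Type*} (s : Finset ι) (f : ι → Sequent Lg At) :
    (∑ i ∈ s, f i).ant = ∑ i ∈ s, (f i).ant := map_sum antHom f s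

theorem suc_sum {ι : Type*} (s : Finset ι) (f : ι → Sequent Lg At) :
    (∑ i ∈ s, f i).suc = ∑ i ∈ s, (f i).suc := map_sum sucHom f s

/-- The number of formulas of a sequent. -/
def card : Sequent Lg At →+ ℕ := Multiset.cardHom.comp antHom + Multiset.cardHom.comp sucHom

theorem card_apply (S : Sequent Lg At) : S.card = Multiset.card S.ant + Multiset.card S.suc := rfl

theorem card_eq_zero {S : Sequent Lg At} : S.card = 0 ↔ S = 0 := by
  rw [card_apply, Nat.add_eq_zero_iff, Multiset.card_eq_zero, Multiset.card_eq_zero]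
  exact ⟨fun h => Sequent.ext h.1 h.2, fun h => h ▸ ⟨rfl, rfl⟩⟩

/-- The sequent `A ⇒`. -/
def L (A : Formula Lg At) : Sequent Lg At := ⟨{A}, 0⟩

/-- The sequent `⇒ A`. -/
def R (A : Formula Lg At) : Sequent Lg At := ⟨0, {A}⟩

/-- All formulas of the sequent are `p`-free. -/
def Free (p : At) (S : Sequent Lg At) : Prop := MPFree p S.ant ∧ MPFree p S.suc

variable {p : At}

theorem free_add {S T : Sequent Lg At} : (S + T).Free p ↔ S.Free p ∧ T.Free p := by
  simp only [Free, MPFree, ant_add, suc_add, Multiset.mem_add]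
  grind

theorem free_zero : (0 : Sequent Lg At).Free p := by simp [Free, MPFree]

@[simp] theorem free_L {A : Formula Lg At} : (L A).Free p ↔ PFree p A := by
  simp [Free, MPFree, L]

@[simp] theorem free_R {A : Formula Lg At} : (R A).Free p ↔ PFree p A := by
  simp [Free, MPFree, R]

theorem free_sum {ι : Type*} {s : Finset ι} {f : ι → Sequent Lg At} :
    (∑ i ∈ s, f i).Free p ↔ ∀ i ∈ s, (f i).Free p := by
  classical
  induction s using Finset.induction_on with
  | empty => simp [free_zero]
  | insert i s hi ih => simp [Finset.sum_insert hi, free_add, ih]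

/-- Riesz refinement: `a ∩ A` is the common part, and the other three pieces are forced by counting.
-/
theorem _root_.Multiset.exists_refinement {α : Type*} {a c A B : Multiset α} (h : a + c = A + B) :
    ∃ a₁ a₂ c₁ c₂, a = a₁ + a₂ ∧ c = c₁ + c₂ ∧ A = a₁ + c₁ ∧ B = a₂ + c₂ := by
  classical
  refine ⟨a ∩ A, a - A, A - a, B - (a - A), ?_, ?_, ?_, ?_⟩ <;>
    (ext x; have := congrArg (Multiset.count x) h; simp at this ⊢; omega)

theorem exists_refinement {a c A B : Sequent Lg At} (h : a + c = A + B) :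
    ∃ a₁ a₂ c₁ c₂, a = a₁ + a₂ ∧ c = c₁ + c₂ ∧ A = a₁ + c₁ ∧ B = a₂ + c₂ := by
  obtain ⟨a₁, a₂, c₁, c₂, h₁, h₂, h₃, h₄⟩ := Multiset.exists_refinement (congrArg ant h)
  obtain ⟨a₁', a₂', c₁', c₂', h₁', h₂', h₃', h₄'⟩ := Multiset.exists_refinement (congrArg suc h)
  exact ⟨⟨a₁, a₁'⟩, ⟨a₂, a₂'⟩, ⟨c₁, c₁'⟩, ⟨c₂, c₂'⟩, Sequent.ext h₁ h₁', Sequent.ext h₂ h₂',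
    Sequent.ext h₃ h₃', Sequent.ext h₄ h₄'⟩

/-- This distributes the contexts of a rule between the two parts of its conclusion. -/
theorem exists_refinement_sum {n : ℕ} {f : Fin n → Sequent Lg At} {A B : Sequent Lg At}
    (h : ∑ i, f i = A + B) :
    ∃ g k : Fin n → Sequent Lg At, (∀ i, f i = g i + k i) ∧ ∑ i, g i = A ∧ ∑ i, k i = B := by
  induction n generalizing A B with
  | zero =>
    rw [Fin.sum_univ_zero] at h
    have h' : A.card + B.card = 0 := by rw [← map_add, ← h, map_zero]
    rw [Nat.add_eq_zero_iff, card_eq_zero, card_eq_zero] at h'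
    exact ⟨0, 0, fun i => i.elim0, by simp [h'.1], by simp [h'.2]⟩
  | succ n ih =>
    rw [Fin.sum_univ_succ] at h
    obtain ⟨a₁, a₂, c₁, c₂, h₁, h₂, rfl, rfl⟩ := exists_refinement h
    obtain ⟨g, k, hgk, hg, hk⟩ := ih h₂
    refine ⟨Fin.cons a₁ g, Fin.cons a₂ k, fun i => ?_, ?_, ?_⟩
    · refine Fin.cases ?_ (fun i => ?_) i
      · simpa using h₁
      · simpa using hgk i
    · simp [Fin.sum_univ_succ, hg]
    · simp [Fin.sum_univ_succ, hk]

theorem eq_zero_or_eq_zero_of_card_add {a b : Sequent Lg At} (h : (a + b).card = 1) :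
    a = 0 ∨ b = 0 := by
  rw [map_add] at h
  rw [← card_eq_zero, ← card_eq_zero (S := b)]
  omega


theorem finite_setOf_add_eq (S : Sequent Lg At) : {T | ∃ U, S = T + U}.Finite := by
  classical
  refine ((Set.finite_Iic S.ant).image2 Sequent.mk (Set.finite_Iic S.suc)).subset ?_
  rintro T ⟨U, rfl⟩
  exact ⟨T.ant, by simp, T.suc, by simp, rfl⟩

theorem properSub_of_add {S T U : Sequent Lg At} (h : S = T + U) (hU : U ≠ 0) : T.ProperSub S := by
  subst h
  refine ⟨by simp, by simp, fun h => hU ?_⟩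
  have := congrArg card h
  rw [map_add] at this
  rw [← card_eq_zero]
  omega

end Sequent

/-! ### Closure under the rules of `CFL_e` -/

open Sequent

/-- The set of sequents `D` is closed under the rules of `CFL_e`. -/
structure CFLeClosed {Lg : Language.{u}} {At : Type v} (D : Sequent Lg At → Prop) : Prop where
  id (A) : D (L A + R A)
  topR (X) : D (R Lg.cTop + X)
  botL (X) : D (L Lg.cBot + X)
  oneR : D (R Lg.cOne)
  zeroL : D (L Lg.cZero)
  oneL {X} : D X → D (L Lg.cOne + X)
  zeroR {X} : D X → D (R Lg.cZero + X)
  conjL₁ {A X} (B) : D (L A + X) → D (L (Lg.cConj A B) + X)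
  conjL₂ {B X} (A) : D (L B + X) → D (L (Lg.cConj A B) + X)
  conjR {A B X} : D (R A + X) → D (R B + X) → D (R (Lg.cConj A B) + X)
  disjL {A B X} : D (L A + X) → D (L B + X) → D (L (Lg.cDisj A B) + X)
  disjR₁ {A X} (B) : D (R A + X) → D (R (Lg.cDisj A B) + X)
  disjR₂ {B X} (A) : D (R B + X) → D (R (Lg.cDisj A B) + X)
  fusL {A B X} : D (L A + (L B + X)) → D (L (Lg.cFus A B) + X)
  fusR {A B X Y} : D (R A + X) → D (R B + Y) → D (R (Lg.cFus A B) + (X + Y))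
  impL {A B X Y} : D (R A + X) → D (L B + Y) → D (L (Lg.cImp A B) + (X + Y))
  impR {A B X} : D (L A + (R B + X)) → D (R (Lg.cImp A B) + X)
  plusL {A B X Y} : D (L A + X) → D (L B + Y) → D (L (Lg.cPlus A B) + (X + Y))
  plusR {A B X} : D (R A + (R B + X)) → D (R (Lg.cPlus A B) + X)

section CFLeDerivations

variable {Lg : Language.{u}} {At : Type v}

@[simp] theorem inst_cConj (σ : ℕ → Formula Lg At) (A B : MetaFormula Lg At) :
    MetaFormula.inst σ (Lg.cConj A B) = Lg.cConj (A.inst σ) (B.inst σ) :=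
  Lg.conj.subst_subst₂ _ A B

@[simp] theorem inst_cDisj (σ : ℕ → Formula Lg At) (A B : MetaFormula Lg At) :
    MetaFormula.inst σ (Lg.cDisj A B) = Lg.cDisj (A.inst σ) (B.inst σ) :=
  Lg.disj.subst_subst₂ _ A B

@[simp] theorem inst_cImp (σ : ℕ → Formula Lg At) (A B : MetaFormula Lg At) :
    MetaFormula.inst σ (Lg.cImp A B) = Lg.cImp (A.inst σ) (B.inst σ) :=
  Lg.imp.subst_subst₂ _ A B

@[simp] theorem inst_cFus (σ : ℕ → Formula Lg At) (A B : MetaFormula Lg At) :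
    MetaFormula.inst σ (Lg.cFus A B) = Lg.cFus (A.inst σ) (B.inst σ) :=
  Lg.fus.subst_subst₂ _ A B

@[simp] theorem inst_cPlus (σ : ℕ → Formula Lg At) (A B : MetaFormula Lg At) :
    MetaFormula.inst σ (Lg.cPlus A B) = Lg.cPlus (A.inst σ) (B.inst σ) :=
  Lg.plus.subst_subst₂ _ A B

@[simp] theorem inst_cZero (σ : ℕ → Formula Lg At) :
    MetaFormula.inst σ (Lg.cZero) = Lg.cZero :=
  Lg.zero.subst_subst₀ _

@[simp] theorem inst_cOne (σ : ℕ → Formula Lg At) :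
    MetaFormula.inst σ (Lg.cOne) = Lg.cOne :=
  Lg.one.subst_subst₀ _

@[simp] theorem inst_cTop (σ : ℕ → Formula Lg At) :
    MetaFormula.inst σ (Lg.cTop) = Lg.cTop :=
  Lg.top.subst_subst₀ _

@[simp] theorem inst_cBot (σ : ℕ → Formula Lg At) :
    MetaFormula.inst σ (Lg.cBot) = Lg.cBot :=
  Lg.bot.subst_subst₀ _

/-- The substitution of `A`, `B` for the formula symbols `0`, `1`. -/
def formSubst (A B : Formula Lg At) : ℕ → Formula Lg At
  | 0 => A
  | _ => B

/-- The substitution of the sides of `X`, `Y` for the contexts `0`, `1` and `2`, `3`. -/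
def ctxSubst (X Y : Sequent Lg At) : ℕ → Multiset (Formula Lg At)
  | 0 => X.ant
  | 1 => X.suc
  | 2 => Y.ant
  | _ => Y.suc

theorem derivable_of_schematic {G : Calculus Lg At} {prems : Multiset (MetaSequent Lg At)}
    {concl : MetaSequent Lg At} {S : Sequent Lg At} (A B : Formula Lg At) (X Y : Sequent Lg At)
    (hR : Rule.schematic prems concl ∈ G)
    (hP : ∀ T ∈ prems, Derivable G (T.inst (formSubst A B) (ctxSubst X Y)))
    (hS : S = concl.inst (formSubst A B) (ctxSubst X Y)) : Derivable G S := by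
  refine .step _ _ S hR ⟨_, _, rfl, hS⟩ fun T hT => ?_
  obtain ⟨U, hU, rfl⟩ := Multiset.mem_map.1 hT
  exact hP U hU

@[simp] theorem inst_var_inr (σ : ℕ → Formula Lg At) (n : ℕ) :
    MetaFormula.inst σ (.var (.inr n)) = σ n := rfl

theorem inst_mseq (σ : ℕ → Formula Lg At) (τ : ℕ → Multiset (Formula Lg At))
    (f : Multiset (MetaFormula Lg At)) (c : Multiset ℕ) (g : Multiset (MetaFormula Lg At))
    (d : Multiset ℕ) : (mseq f c g d).inst σ τ =
      ⟨f.map (MetaFormula.inst σ) + c.bind τ, g.map (MetaFormula.inst σ) + d.bind τ⟩ := rfl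

set_option linter.unusedSimpArgs false in
theorem cFLeClosed_derivable_cFLe : CFLeClosed (Derivable (CFLe Lg At)) := by
  constructor
  case id =>
    intro A
    refine derivable_of_schematic A A 0 0 (.inl rfl) ?_ ?_ <;>
      simp_all [inst_mseq, formSubst, ctxSubst, L, R, add_def]
  case topR =>
    intro X
    refine derivable_of_schematic Lg.cOne Lg.cOne X 0 (.inr <| .inl rfl) ?_ ?_ <;>
      simp_all [inst_mseq, formSubst, ctxSubst, L, R, add_def]
  case botL =>
    intro X
    refine derivable_of_schematic Lg.cOne Lg.cOne X 0 (.inr <| .inr <| .inl rfl) ?_ ?_ <;>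
      simp_all [inst_mseq, formSubst, ctxSubst, L, R, add_def]
  case oneR =>
    refine derivable_of_schematic Lg.cOne Lg.cOne 0 0 (.inr <| .inr <| .inr <| .inl rfl) ?_ ?_ <;>
      simp_all [inst_mseq, formSubst, ctxSubst, L, R, add_def]
  case zeroL =>
    refine derivable_of_schematic Lg.cOne Lg.cOne 0 0 (.inr <| .inr <| .inr <| .inr <| .inl rfl)
      ?_ ?_ <;>
      simp_all [inst_mseq, formSubst, ctxSubst, L, R, add_def]
  case oneL =>
    intro X h
    refine derivable_of_schematic Lg.cOne Lg.cOne X 0 (.inr <| .inr <| .inr <| .inr <| .inr <|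
      .inl rfl) ?_ ?_ <;>
      simp_all [inst_mseq, formSubst, ctxSubst, L, R, add_def]
  case zeroR =>
    intro X h
    refine derivable_of_schematic Lg.cOne Lg.cOne X 0 (.inr <| .inr <| .inr <| .inr <| .inr <|
      .inr <| .inl rfl) ?_ ?_ <;>
      simp_all [inst_mseq, formSubst, ctxSubst, L, R, add_def]
  case conjL₁ =>
    intro A X B h
    refine derivable_of_schematic A B X 0 (.inr <| .inr <| .inr <| .inr <| .inr <| .inr <| .inr <|
      .inl rfl) ?_ ?_ <;>
      simp_all [inst_mseq, formSubst, ctxSubst, L, R, add_def]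
  case conjL₂ =>
    intro B X A h
    refine derivable_of_schematic A B X 0 (.inr <| .inr <| .inr <| .inr <| .inr <| .inr <| .inr <|
      .inr <| .inl rfl) ?_ ?_ <;>
      simp_all [inst_mseq, formSubst, ctxSubst, L, R, add_def]
  case conjR =>
    intro A B X h h'
    refine derivable_of_schematic A B X 0 (.inr <| .inr <| .inr <| .inr <| .inr <| .inr <| .inr <|
      .inr <| .inr <| .inl rfl) ?_ ?_ <;>
      simp_all [inst_mseq, formSubst, ctxSubst, L, R, add_def]
  case disjL =>
    intro A B X h h'
    refine derivable_of_schematic A B X 0 (.inr <| .inr <| .inr <| .inr <| .inr <| .inr <| .inr <|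
      .inr <| .inr <| .inr <| .inl rfl) ?_ ?_ <;>
      simp_all [inst_mseq, formSubst, ctxSubst, L, R, add_def]
  case disjR₁ =>
    intro A X B h
    refine derivable_of_schematic A B X 0 (.inr <| .inr <| .inr <| .inr <| .inr <| .inr <| .inr <|
      .inr <| .inr <| .inr <| .inr <| .inl rfl) ?_ ?_ <;>
      simp_all [inst_mseq, formSubst, ctxSubst, L, R, add_def]
  case disjR₂ =>
    intro B X A h
    refine derivable_of_schematic A B X 0 (.inr <| .inr <| .inr <| .inr <| .inr <| .inr <| .inr <|
      .inr <| .inr <| .inr <| .inr <| .inr <| .inl rfl) ?_ ?_ <;>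
      simp_all [inst_mseq, formSubst, ctxSubst, L, R, add_def]
  case fusL =>
    intro A B X h
    refine derivable_of_schematic A B X 0 (.inr <| .inr <| .inr <| .inr <| .inr <| .inr <| .inr <|
      .inr <| .inr <| .inr <| .inr <| .inr <| .inr <| .inl rfl) ?_ ?_ <;>
      simp_all [inst_mseq, formSubst, ctxSubst, L, R, add_def]
    rwa [Multiset.cons_swap]
  case fusR =>
    intro A B X Y h h'
    refine derivable_of_schematic A B X Y (.inr <| .inr <| .inr <| .inr <| .inr <| .inr <| .inr <|
      .inr <| .inr <| .inr <| .inr <| .inr <| .inr <| .inr <| .inl rfl) ?_ ?_ <;>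
      simp_all [inst_mseq, formSubst, ctxSubst, L, R, add_def]
  case impL =>
    intro A B X Y h h'
    refine derivable_of_schematic A B X Y (.inr <| .inr <| .inr <| .inr <| .inr <| .inr <| .inr <|
      .inr <| .inr <| .inr <| .inr <| .inr <| .inr <| .inr <| .inr <| .inl rfl) ?_ ?_ <;>
      simp_all [inst_mseq, formSubst, ctxSubst, L, R, add_def]
  case impR =>
    intro A B X h
    refine derivable_of_schematic A B X 0 (.inr <| .inr <| .inr <| .inr <| .inr <| .inr <| .inr <|
      .inr <| .inr <| .inr <| .inr <| .inr <| .inr <| .inr <| .inr <| .inr <| .inl rfl) ?_ ?_ <;>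
      simp_all [inst_mseq, formSubst, ctxSubst, L, R, add_def]
  case plusL =>
    intro A B X Y h h'
    refine derivable_of_schematic A B X Y (.inr <| .inr <| .inr <| .inr <| .inr <| .inr <| .inr <|
      .inr <| .inr <| .inr <| .inr <| .inr <| .inr <| .inr <| .inr <| .inr <| .inr <| .inl rfl)
      ?_ ?_ <;>
      simp_all [inst_mseq, formSubst, ctxSubst, L, R, add_def]
  case plusR =>
    intro A B X h
    refine derivable_of_schematic A B X 0 (.inr <| .inr <| .inr <| .inr <| .inr <| .inr <| .inr <|
      .inr <| .inr <| .inr <| .inr <| .inr <| .inr <| .inr <| .inr <| .inr <| .inr <| .inr <| rfl)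
      ?_ ?_ <;>
      simp_all [inst_mseq, formSubst, ctxSubst, L, R, add_def]
    rwa [Multiset.cons_swap]

end CFLeDerivations

/-! ### Iterated connectives -/

namespace CFLeClosed

variable {Lg : Language.{u}} {At : Type v} {D : Sequent Lg At → Prop} (hD : CFLeClosed D)
include hD

theorem bigFusL {l : List (Formula Lg At)} {X : Sequent Lg At} (h : D ((l.map L).sum + X)) :
    D (L (Lg.bigFus l) + X) := by
  induction l using Language.bigFus.induct generalizing X with
  | case1 => exact hD.oneL (by simpa using h)
  | case2 A => simpa [Language.bigFus] using h
  | case3 A B l ih =>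
    refine hD.fusL ?_
    rw [add_left_comm]
    refine ih ?_
    rw [List.map_cons, List.sum_cons] at h
    convert h using 1
    abel

theorem bigPlusR {l : List (Formula Lg At)} {X : Sequent Lg At} (h : D ((l.map R).sum + X)) :
    D (R (Lg.bigPlus l) + X) := by
  induction l using Language.bigPlus.induct generalizing X with
  | case1 => exact hD.zeroR (by simpa using h)
  | case2 A => simpa [Language.bigPlus] using h
  | case3 A B l ih =>
    refine hD.plusR ?_
    rw [add_left_comm]
    refine ih ?_
    rw [List.map_cons, List.sum_cons] at h
    convert h using 1
    abel

theorem bigFusR {ι : Type*} {l : List ι} {A : ι → Formula Lg At} {X : ι → Sequent Lg At}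
    (h : ∀ i ∈ l, D (R (A i) + X i)) : D (R (Lg.bigFus (l.map A)) + (l.map X).sum) := by
  induction l with
  | nil => simpa [Language.bigFus] using hD.oneR
  | cons i l ih =>
    cases l with
    | nil => simpa [Language.bigFus] using h
    | cons j l => exact hD.fusR (h i (by simp)) (ih fun k hk => h k (by simp [hk]))

theorem bigPlusL {ι : Type*} {l : List ι} {A : ι → Formula Lg At} {X : ι → Sequent Lg At}
    (h : ∀ i ∈ l, D (L (A i) + X i)) : D (L (Lg.bigPlus (l.map A)) + (l.map X).sum) := by
  induction l with
  | nil => simpa [Language.bigPlus] using hD.zeroL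
  | cons i l ih =>
    cases l with
    | nil => simpa [Language.bigPlus] using h
    | cons j l => exact hD.plusL (h i (by simp)) (ih fun k hk => h k (by simp [hk]))

theorem bigFusR_self (l : List (Formula Lg At)) : D (R (Lg.bigFus l) + (l.map L).sum) := by
  simpa using hD.bigFusR (l := l) (A := _root_.id) (X := L) fun A _ => by
    simpa [add_comm] using hD.id A

theorem bigPlusL_self (l : List (Formula Lg At)) : D (L (Lg.bigPlus l) + (l.map R).sum) := by
  simpa using hD.bigPlusL (l := l) (A := _root_.id) (X := R) fun A _ => hD.id A

theorem bigConjL {l : List (Formula Lg At)} {A : Formula Lg At} {X : Sequent Lg At} (hA : A ∈ l)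
    (h : D (L A + X)) : D (L (Lg.bigConj l) + X) := by
  induction l with
  | nil => simp at hA
  | cons B l ih =>
    rcases List.mem_cons.1 hA with rfl | hA
    · exact hD.conjL₁ _ h
    · exact hD.conjL₂ _ (ih hA)

theorem bigConjR {l : List (Formula Lg At)} {X : Sequent Lg At} (h : ∀ A ∈ l, D (R A + X)) :
    D (R (Lg.bigConj l) + X) := by
  induction l with
  | nil => exact hD.topR X
  | cons B l ih => exact hD.conjR (h B (by simp)) (ih fun C hC => h C (by simp [hC]))

theorem bigDisjL {l : List (Formula Lg At)} {X : Sequent Lg At} (h : ∀ A ∈ l, D (L A + X)) :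
    D (L (Lg.bigDisj l) + X) := by
  induction l with
  | nil => exact hD.botL X
  | cons B l ih => exact hD.disjL (h B (by simp)) (ih fun C hC => h C (by simp [hC]))

theorem bigDisjR {l : List (Formula Lg At)} {A : Formula Lg At} {X : Sequent Lg At} (hA : A ∈ l)
    (h : D (R A + X)) : D (R (Lg.bigDisj l) + X) := by
  induction l with
  | nil => simp at hA
  | cons B l ih =>
    rcases List.mem_cons.1 hA with rfl | hA
    · exact hD.disjR₁ _ h
    · exact hD.disjR₂ _ (ih hA)

end CFLeClosed

/-! ### Transfer of the rules of CFL_e to a calculus for an extension -/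

section Logics

variable {Lg : Language.{u}} {At : Type v}

theorem sum_map_L (l : List (Formula Lg At)) : (l.map L).sum = ⟨l, 0⟩ := by
  induction l with
  | nil => rfl
  | cons A l ih => simp [ih, L, mk_add_mk]

theorem sum_map_R (l : List (Formula Lg At)) : (l.map R).sum = ⟨0, l⟩ := by
  induction l with
  | nil => rfl
  | cons A l ih => simp [ih, R, mk_add_mk]

theorem Sequent.exists_eq_sum_add_sum (S : Sequent Lg At) : ∃ Γ Δ : List (Formula Lg At),
    S = (Γ.map L).sum + (Δ.map R).sum := by
  obtain ⟨⟨Γ⟩, ⟨Δ⟩⟩ := S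
  exact ⟨Γ, Δ, by rw [sum_map_L, sum_map_R]; simp [mk_add_mk]⟩

theorem IsCalculusFor.derivable_iff {G : Calculus Lg At} {T : Logic Lg At}
    (hG : IsCalculusFor G T) (Γ Δ : List (Formula Lg At)) :
    Derivable G ((Γ.map L).sum + (Δ.map R).sum) ↔ Lg.cImp (Lg.bigFus Γ) (Lg.bigPlus Δ) ∈ T.thms := by
  rw [← hG Γ Δ, sum_map_L, sum_map_R, mk_add_mk, add_zero, zero_add]

/-- Each hypothesis is moved across the arrow by the right implication rule and then discharged by
modus ponens; this takes the place of cut. -/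
theorem Logic.ExtendsCFLe.mem_of_derivable {T : Logic Lg At} (hT : T.ExtendsCFLe)
    {l : List (Formula Lg At)} (hl : ∀ A ∈ l, A ∈ T.thms) {B : Formula Lg At}
    (h : Derivable (CFLe Lg At) (R B + (l.map L).sum)) : B ∈ T.thms := by
  induction l generalizing B with
  | nil => exact hT B (by simpa [R] using h)
  | cons A l ih =>
    refine T.mp A B (ih (fun C hC => hl C (by simp [hC])) ?_) (hl A (by simp))
    refine cFLeClosed_derivable_cFLe.impR ?_
    rwa [List.map_cons, List.sum_cons, add_left_comm] at h

/-- In one direction the theorem `∗Γ → +Δ` itself is the only hypothesis needed. In the other, the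
sequent is folded into `∗Γ → +Δ` inside CFL_e and the hypotheses are discharged. -/
theorem IsCalculusFor.derivable_iff_exists_list {G : Calculus Lg At} {T : Logic Lg At}
    (hG : IsCalculusFor G T) (hT : T.ExtendsCFLe) (S : Sequent Lg At) :
    Derivable G S ↔ ∃ l : List (Formula Lg At), (∀ A ∈ l, A ∈ T.thms) ∧
      Derivable (CFLe Lg At) (S + (l.map L).sum) := by
  have hC := cFLeClosed_derivable_cFLe (Lg := Lg) (At := At)
  obtain ⟨Γ, Δ, rfl⟩ := S.exists_eq_sum_add_sum
  rw [hG.derivable_iff]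
  constructor
  · intro h
    refine ⟨[_], by simpa using h, ?_⟩
    have := hC.impL (hC.bigFusR_self Γ) (hC.bigPlusL_self Δ)
    simpa [add_comm] using this
  · rintro ⟨l, hl, h⟩
    refine hT.mem_of_derivable hl (hC.impR (hC.bigFusL ?_))
    rw [add_left_comm]
    refine hC.bigPlusR ?_
    convert h using 1
    abel

/-- A fusion of theorems is a theorem. Having one hypothesis makes adjunction applicable to
context-sharing rules. -/
theorem IsCalculusFor.derivable_iff_exists {G : Calculus Lg At} {T : Logic Lg At}
    (hG : IsCalculusFor G T) (hT : T.ExtendsCFLe) (S : Sequent Lg At) :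
    Derivable G S ↔ ∃ A ∈ T.thms, Derivable (CFLe Lg At) (S + L A) := by
  have hC := cFLeClosed_derivable_cFLe (Lg := Lg) (At := At)
  rw [hG.derivable_iff_exists_list hT]
  constructor
  · rintro ⟨l, hl, h⟩
    refine ⟨Lg.bigFus l, hT.mem_of_derivable hl (hC.bigFusR_self l), ?_⟩
    rw [add_comm] at h ⊢
    exact hC.bigFusL h
  · rintro ⟨A, hA, h⟩
    exact ⟨[A], by simpa using hA, by simpa using h⟩

/-- The theorems used as hypotheses travel through a CFL_e rule as part of its context, so each rule
need only be applied in CFL_e with a larger context. -/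
theorem IsCalculusFor.cFLeClosed {G : Calculus Lg At} {T : Logic Lg At}
    (hG : IsCalculusFor G T) (hT : T.ExtendsCFLe) : CFLeClosed (Derivable G) := by
  have hC := cFLeClosed_derivable_cFLe (Lg := Lg) (At := At)
  have key := hG.derivable_iff_exists hT
  have axiom_case : ∀ {S}, Derivable (CFLe Lg At) S → Derivable G S := fun {S} h =>
    (hG.derivable_iff_exists_list hT S).2 ⟨[], by simp, by simpa using h⟩
  have unary : ∀ {S S'}, (∀ X, Derivable (CFLe Lg At) (S + X) → Derivable (CFLe Lg At) (S' + X)) →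
      Derivable G S → Derivable G S' := by
    intro S S' h hS
    obtain ⟨A, hA, hS⟩ := (key _).1 hS
    exact (key _).2 ⟨A, hA, h _ hS⟩
  have additive : ∀ {S S' S''}, (∀ X, Derivable (CFLe Lg At) (S + X) →
      Derivable (CFLe Lg At) (S' + X) → Derivable (CFLe Lg At) (S'' + X)) →
      Derivable G S → Derivable G S' → Derivable G S'' := by
    intro S S' S'' h hS hS'
    obtain ⟨A, hA, hS⟩ := (key _).1 hS
    obtain ⟨B, hB, hS'⟩ := (key _).1 hS'
    -- Both premises need the same context, so the two hypotheses are replaced by their conjunction.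
    refine (key _).2 ⟨_, T.adj A B hA hB, h _ ?_ ?_⟩
    · rw [add_comm] at hS ⊢
      exact hC.conjL₁ _ hS
    · rw [add_comm] at hS' ⊢
      exact hC.conjL₂ _ hS'
  have multiplicative : ∀ {S S' S''}, (∀ X Y, Derivable (CFLe Lg At) (S + X) →
      Derivable (CFLe Lg At) (S' + Y) → Derivable (CFLe Lg At) (S'' + (X + Y))) →
      Derivable G S → Derivable G S' → Derivable G S'' := by
    intro S S' S'' h hS hS'
    obtain ⟨A, hA, hS⟩ := (key _).1 hS
    obtain ⟨B, hB, hS'⟩ := (key _).1 hS'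
    exact (hG.derivable_iff_exists_list hT _).2
      ⟨[A, B], by simp [hA, hB], by simpa using h _ _ hS hS'⟩
  constructor
  case id => exact fun A => axiom_case (hC.id A)
  case topR => exact fun X => axiom_case (hC.topR X)
  case botL => exact fun X => axiom_case (hC.botL X)
  case oneR => exact axiom_case hC.oneR
  case zeroL => exact axiom_case hC.zeroL
  case oneL => exact unary fun Z h => by rw [add_assoc] at *; exact hC.oneL h
  case zeroR => exact unary fun Z h => by rw [add_assoc] at *; exact hC.zeroR h
  case conjL₁ => exact fun B => unary fun Z h => by rw [add_assoc] at *; exact hC.conjL₁ B h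
  case conjL₂ => exact fun B => unary fun Z h => by rw [add_assoc] at *; exact hC.conjL₂ B h
  case disjR₁ => exact fun B => unary fun Z h => by rw [add_assoc] at *; exact hC.disjR₁ B h
  case disjR₂ => exact fun B => unary fun Z h => by rw [add_assoc] at *; exact hC.disjR₂ B h
  case fusL => exact unary fun Z h => by simp only [add_assoc] at *; exact hC.fusL h
  case impR => exact unary fun Z h => by simp only [add_assoc] at *; exact hC.impR h
  case plusR => exact unary fun Z h => by simp only [add_assoc] at *; exact hC.plusR h
  case conjR => exact additive fun Z h h' => by rw [add_assoc] at *; exact hC.conjR h h'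
  case disjL => exact additive fun Z h h' => by rw [add_assoc] at *; exact hC.disjL h h'
  case fusR =>
    exact multiplicative fun Z W h h' => by
      rw [add_assoc] at *; rw [add_add_add_comm]; exact hC.fusR h h'
  case impL =>
    exact multiplicative fun Z W h h' => by
      rw [add_assoc] at *; rw [add_add_add_comm]; exact hC.impL h h'
  case plusL =>
    exact multiplicative fun Z W h h' => by
      rw [add_assoc] at *; rw [add_add_add_comm]; exact hC.plusL h h'

end Logics

/-! ### Semi-analytic rules with arbitrary contexts -/

section Semianalytic

variable {Lg : Language.{u}} {At : Type v}

/-- A rule which infers `main + ∑ ctx i` from the sequents `ctx i + act i r`, for arbitrary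
contexts `ctx`: a semi-analytic rule whose formula symbols have been instantiated. -/
structure ContextRule (R : Rule Lg At) where
  n : ℕ
  m : Fin n → ℕ
  main : Sequent Lg At
  act : (i : Fin n) → Fin (m i) → Sequent Lg At
  card_main : main.card = 1
  free_act : ∀ {p : At}, main.Free p → ∀ i r, (act i r).Free p
  inst : ∀ ctx : Fin n → Sequent Lg At,
    R.Inst (∑ i, ∑ r, {ctx i + act i r}) (main + ∑ i, ctx i)

theorem MetaFormula.vars_inst_subset {A B : MetaFormula Lg At} (h : A.vars ⊆ B.vars)
    (σ : ℕ → Formula Lg At) : (A.inst σ).vars ⊆ (B.inst σ).vars := by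
  rw [MetaFormula.inst, MetaFormula.inst, Form.vars_subst, Form.vars_subst]
  exact Set.biUnion_subset_biUnion_left h

theorem pFree_of_vars_subset {p : At} {A B : Formula Lg At} (h : A.vars ⊆ B.vars)
    (hB : PFree p B) : PFree p A := fun hA => hB (h hA)

namespace SemiAnalyticData

variable (d : SemiAnalyticData Lg At) (σ : ℕ → Formula Lg At)

/-- The active formulas of a premise, instantiated. -/
def active (i : Fin d.n) (r : Fin (d.m i)) : Sequent Lg At :=
  ⟨(d.φ i r).map (MetaFormula.inst σ), (d.ψ i r).map (MetaFormula.inst σ)⟩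

theorem active_free {p : At} (h : PFree p (d.main.inst σ)) (i : Fin d.n) (r : Fin (d.m i)) :
    (d.active σ i r).Free p := by
  have key : ∀ A ∈ d.φ i r + d.ψ i r, PFree p (A.inst σ) := fun A hA =>
    pFree_of_vars_subset (MetaFormula.vars_inst_subset (d.occurrence i r A hA) σ) h
  constructor <;> intro A hA <;> obtain ⟨B, hB, rfl⟩ := Multiset.mem_map.1 hA <;>
    exact key B (by simp [hB])

theorem prems_inst (τ : ℕ → Multiset (Formula Lg At)) :
    d.prems.map (MetaSequent.inst σ τ) =
      ∑ i, ∑ r, {⟨τ (d.Γ i), τ (d.Δ i)⟩ + d.active σ i r} := by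
  rw [← Fintype.sum_sigma', SemiAnalyticData.prems, Multiset.map_map, Finset.sum,
    ← Multiset.sum_map_singleton (Multiset.map _ _), Multiset.map_map]
  congr 2
  funext x
  simp [inst_mseq, active, add_def, add_comm]

theorem leftCtxs_bind (τ : ℕ → Multiset (Formula Lg At)) :
    d.leftCtxs.bind τ = ∑ i, τ (d.Γ i) := by
  rw [leftCtxs, Multiset.bind_map]; rfl

theorem rightCtxs_bind (τ : ℕ → Multiset (Formula Lg At)) :
    d.rightCtxs.bind τ = ∑ i, τ (d.Δ i) := by
  rw [rightCtxs, Multiset.bind_map]; rfl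

/-- Distinctness of the context variables lets all contexts be prescribed independently; the value
`0` elsewhere plays no role. -/
theorem exists_ctx (ctx : Fin d.n → Sequent Lg At) :
    ∃ τ : ℕ → Multiset (Formula Lg At), ∀ i, ctx i = ⟨τ (d.Γ i), τ (d.Δ i)⟩ := by
  refine ⟨Function.extend (Sum.elim d.Γ d.Δ)
    (Sum.elim (fun i => (ctx i).ant) (fun i => (ctx i).suc)) 0, fun i => ?_⟩
  have h₁ := d.distinct.extend_apply
    (Sum.elim (fun i => (ctx i).ant) (fun i => (ctx i).suc)) 0 (.inl i)
  have h₂ := d.distinct.extend_apply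
    (Sum.elim (fun i => (ctx i).ant) (fun i => (ctx i).suc)) 0 (.inr i)
  simp only [Sum.elim_inl, Sum.elim_inr] at h₁ h₂
  rw [h₁, h₂]

theorem leftRule_concl_inst (τ : ℕ → Multiset (Formula Lg At)) :
    (mseq {d.main} d.leftCtxs 0 d.rightCtxs).inst σ τ =
      L (d.main.inst σ) + ∑ i, ⟨τ (d.Γ i), τ (d.Δ i)⟩ := by
  rw [inst_mseq, leftCtxs_bind, rightCtxs_bind]
  ext1 <;> simp [L, ant_sum, suc_sum]

theorem rightRule_concl_inst (τ : ℕ → Multiset (Formula Lg At)) :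
    (mseq 0 d.leftCtxs {d.main} d.rightCtxs).inst σ τ =
      R (d.main.inst σ) + ∑ i, ⟨τ (d.Γ i), τ (d.Δ i)⟩ := by
  rw [inst_mseq, leftCtxs_bind, rightCtxs_bind]
  ext1 <;> simp [R, ant_sum, suc_sum]

/-- The left rule with instantiated formula symbols. -/
def leftContextRule : ContextRule d.leftRule where
  n := d.n
  m := d.m
  main := L (d.main.inst σ)
  act := d.active σ
  card_main := rfl
  free_act h := d.active_free σ (free_L.1 h)
  inst ctx := by
    obtain ⟨τ, hτ⟩ := d.exists_ctx ctx
    refine ⟨σ, τ, ?_, ?_⟩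
    · simp only [prems_inst, hτ]
    · simp only [leftRule_concl_inst, hτ]

/-- The right rule with instantiated formula symbols. -/
def rightContextRule : ContextRule d.rightRule where
  n := d.n
  m := d.m
  main := R (d.main.inst σ)
  act := d.active σ
  card_main := rfl
  free_act h := d.active_free σ (free_R.1 h)
  inst ctx := by
    obtain ⟨τ, hτ⟩ := d.exists_ctx ctx
    refine ⟨σ, τ, ?_, ?_⟩
    · simp only [prems_inst, hτ]
    · simp only [rightRule_concl_inst, hτ]

end SemiAnalyticData

theorem exists_contextRule {Q : Rule Lg At}
    (hQ : (∃ d : SemiAnalyticData Lg At, Q = d.leftRule) ∨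
      ∃ d : SemiAnalyticData Lg At, Q = d.rightRule)
    {P : Multiset (Sequent Lg At)} {U : Sequent Lg At} (h : Q.Inst P U) :
    ∃ (c : ContextRule Q) (ctx : Fin c.n → Sequent Lg At),
      P = ∑ i, ∑ r, {ctx i + c.act i r} ∧ U = c.main + ∑ i, ctx i := by
  rcases hQ with ⟨d, rfl⟩ | ⟨d, rfl⟩ <;> obtain ⟨σ, τ, hP, hU⟩ := h
  · exact ⟨d.leftContextRule σ, _, hP.trans (d.prems_inst σ τ),
      hU.trans (d.leftRule_concl_inst σ τ)⟩
  · exact ⟨d.rightContextRule σ, _, hP.trans (d.prems_inst σ τ),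
      hU.trans (d.rightRule_concl_inst σ τ)⟩

theorem mem_sum_sum_singleton {n : ℕ} {m : Fin n → ℕ} {f : (i : Fin n) → Fin (m i) → Sequent Lg At}
    {T : Sequent Lg At} : T ∈ ∑ i, ∑ r, ({f i r} : Multiset _) ↔ ∃ i r, T = f i r := by
  simp [Multiset.mem_sum]

theorem ContextRule.derivable {H : Calculus Lg At} {Q : Rule Lg At} (hQ : Q ∈ H)
    (c : ContextRule Q) {ctx : Fin c.n → Sequent Lg At}
    (h : ∀ i r, Derivable H (ctx i + c.act i r)) : Derivable H (c.main + ∑ i, ctx i) := by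
  refine .step Q _ _ hQ (c.inst ctx) fun T hT => ?_
  obtain ⟨i, r, rfl⟩ := mem_sum_sum_singleton.1 hT
  exact h i r

/-- A single formula is indivisible under refinement, so it belongs wholly to `S` or wholly to `X`.
-/
theorem Sequent.split_main {M C S X : Sequent Lg At} (hM : M.card = 1) (h : S + X = M + C) :
    (∃ S', S = M + S' ∧ C = S' + X) ∨ ∃ X', X = M + X' ∧ C = S + X' := by
  obtain ⟨a₁, a₂, c₁, c₂, rfl, rfl, rfl, rfl⟩ := exists_refinement h.symm
  rcases eq_zero_or_eq_zero_of_card_add hM with rfl | rfl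
  · exact .inr ⟨c₂, by simp, by simp⟩
  · exact .inl ⟨c₁, by simp, by simp⟩

theorem _root_.List.finite_setOf_length_le_forall_mem {α : Type*} {K : Set α} (hK : K.Finite)
    (n : ℕ) : {l : List α | l.length ≤ n ∧ ∀ x ∈ l, x ∈ K}.Finite := by
  have := hK.to_subtype
  refine ((List.finite_length_le K n).image (List.map Subtype.val)).subset ?_
  rintro l ⟨hl, hK⟩
  lift l to List K using hK
  exact ⟨l, by simpa using hl, rfl⟩

end Semianalytic

/-! ### Interpolants when the last rule is left or right semi-analytic -/

section Interpolants

variable {Lg : Language.{u}} {At : Type v} {H : Calculus Lg At} {p : At}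

/-- `I` is a left uniform interpolant of the sequent `S`. -/
structure IsInterpolant (H : Calculus Lg At) (p : At) (S : Sequent Lg At) (I : Formula Lg At) :
    Prop where
  pFree : PFree p I
  left : Derivable H (S + L I)
  right : ∀ X : Sequent Lg At, X.Free p → Derivable H (S + X) → Derivable H (X + R I)

/-- `F` interpolates the derivable sequent `S + X`. -/
structure Interpolates (H : Calculus Lg At) (p : At) (S X : Sequent Lg At) (F : Formula Lg At) :
    Prop where
  pFree : PFree p F
  left : Derivable H (S + L F)
  right : Derivable H (X + R F)

theorem exists_interpolant_of_free (hD : CFLeClosed (Derivable H)) {S : Sequent Lg At}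
    (hS : S.Free p) : ∃ I, IsInterpolant H p S I := by
  obtain ⟨Γ, Δ, rfl⟩ := S.exists_eq_sum_add_sum
  refine ⟨Lg.cImp (Lg.bigFus Γ) (Lg.bigPlus Δ), ?_, ?_, fun X _ h => ?_⟩
  · rw [sum_map_L, sum_map_R, mk_add_mk] at hS
    exact Lg.imp.pFree₂ (pFree_bigFus fun A hA => hS.1 A (by simpa using hA))
      (pFree_bigPlus fun A hA => hS.2 A (by simpa using hA))
  · rw [add_comm]
    exact hD.impL (hD.bigFusR_self Γ) (hD.bigPlusL_self Δ)
  · rw [add_comm X]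
    refine hD.impR (hD.bigFusL ?_)
    rw [add_left_comm]
    refine hD.bigPlusR ?_
    convert h using 1
    abel

/-- Dropping the `X`-share of each context gives an instance of the same rule with conclusion `S`.
The premises over one context share their `X`-part, so their interpolants are conjoined; different
contexts have separate parts, so the conjunctions are fused. -/
theorem exists_finite_of_main_left (hD : CFLeClosed (Derivable H)) {S : Sequent Lg At}
    (hfin : {P : Multiset (Sequent Lg At) | ∃ Q ∈ H, Q.Inst P S}.Finite)
    {I : Sequent Lg At → Formula Lg At}
    (hI : ∀ Q ∈ H, ∀ P, Q.Inst P S → ∀ T ∈ P, IsInterpolant H p T (I T)) :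
    ∃ C : Set (Formula Lg At), C.Finite ∧ ∀ Q ∈ H, ∀ (c : ContextRule Q)
      (ctx : Fin c.n → Sequent Lg At) (S' X : Sequent Lg At), X.Free p → S = c.main + S' →
      ∑ i, ctx i = S' + X → (∀ i r, Derivable H (ctx i + c.act i r)) →
      ∃ F ∈ C, Interpolates H p S X F := by
  classical
  -- The candidates depend only on the multiset `P` of premises of an instance concluding `S`, not
  -- on the rule or the grouping of premises by context. Finitely many `P` occur, so the candidates
  -- are finite in number.
  let conj : Multiset (Sequent Lg At) → Formula Lg At := fun N => Lg.bigConj (N.toList.map I)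
  let lists : Multiset (Sequent Lg At) → Set (List (Formula Lg At)) := fun P =>
    {l | l.length ≤ P.card ∧ ∀ A ∈ l, A ∈ conj '' Set.Iic P}
  have lists_finite : ∀ P, (lists P).Finite := fun P =>
    List.finite_setOf_length_le_forall_mem ((Set.finite_Iic P).image conj) _
  refine ⟨⋃ P ∈ {P : Multiset (Sequent Lg At) | ∃ Q ∈ H, Q.Inst P S},
    Lg.bigFus '' lists P ∪ (fun l => Lg.cFus (Lg.bigFus l) Lg.cTop) '' lists P,
    hfin.biUnion fun P _ => ((lists_finite P).image _).union ((lists_finite P).image _), ?_⟩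
  intro Q hQ c ctx S' X hX hS hctx hprem
  obtain ⟨g, k, hgk, hg, hk⟩ := exists_refinement_sum hctx
  rw [← hk, free_sum] at hX
  have hinst := c.inst g
  rw [hg, ← hS] at hinst
  set P := ∑ i, ∑ r, ({g i + c.act i r} : Multiset (Sequent Lg At)) with hP
  have hIP : ∀ i r, IsInterpolant H p (g i + c.act i r) (I (g i + c.act i r)) := fun i r =>
    hI Q hQ P hinst _ (mem_sum_sum_singleton.2 ⟨i, r, rfl⟩)
  let N : Fin c.n → Multiset (Sequent Lg At) := fun i => ∑ r, {g i + c.act i r}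
  have hNP : ∀ i, N i ≤ P := fun i =>
    Finset.single_le_sum (f := N) (fun _ _ => Multiset.zero_le _) (Finset.mem_univ i)
  have mem_N : ∀ i T, T ∈ N i ↔ ∃ r, T = g i + c.act i r := by simp [N, Multiset.mem_sum]
  let A : Fin c.n → Formula Lg At := fun i => conj (N i)
  have pFree_A : ∀ i, PFree p (A i) := fun i => pFree_bigConj fun B hB => by
    obtain ⟨T, hT, rfl⟩ := List.mem_map.1 hB
    obtain ⟨r, rfl⟩ := (mem_N i T).1 (Multiset.mem_toList.1 hT)
    exact (hIP i r).pFree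
  have left_A : ∀ i r, Derivable H (L (A i) + (g i + c.act i r)) := fun i r =>
    hD.bigConjL (A := I (g i + c.act i r))
      (List.mem_map.2 ⟨_, Multiset.mem_toList.2 ((mem_N i _).2 ⟨r, rfl⟩), rfl⟩)
      (by rw [add_comm]; exact (hIP i r).left)
  have right_A : ∀ i, Derivable H (R (A i) + k i) := fun i => hD.bigConjR fun B hB => by
    obtain ⟨T, hT, rfl⟩ := List.mem_map.1 hB
    obtain ⟨r, rfl⟩ := (mem_N i T).1 (Multiset.mem_toList.1 hT)
    rw [add_comm]
    refine (hIP i r).right _ (hX i (Finset.mem_univ i)) ?_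
    convert hprem i r using 1
    rw [hgk]
    abel
  have extend : ∀ E : Fin c.n → Sequent Lg At, (∀ i r, Derivable H (E i + (g i + c.act i r))) →
      Derivable H (∑ i, E i + S) := fun E hE => by
    have := c.derivable hQ (ctx := fun i => E i + g i) fun i r => by rw [add_assoc]; exact hE i r
    rwa [Finset.sum_add_distrib, hg, add_left_comm, ← hS] at this
  -- Contexts without premises are left out: their number is not controlled by `P`, while that of
  -- the others is at most the number of premises.
  let s : Finset (Fin c.n) := Finset.univ.filter fun i => c.m i ≠ 0
  have hs : s.toList.map A ∈ lists P := by
    constructor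
    · have : P.card = ∑ i, c.m i := by simp [hP]
      rw [List.length_map, Finset.length_toList, this, Finset.card_eq_sum_ones]
      refine (Finset.sum_le_sum fun i hi => ?_).trans
        (Finset.sum_le_sum_of_subset (Finset.subset_univ s))
      exact Nat.one_le_iff_ne_zero.2 (Finset.mem_filter.1 hi).2
    · intro B hB
      obtain ⟨i, -, rfl⟩ := List.mem_map.1 hB
      exact ⟨N i, hNP i, rfl⟩
  have pFree_s : PFree p (Lg.bigFus (s.toList.map A)) := pFree_bigFus fun B hB => by
    obtain ⟨i, -, rfl⟩ := List.mem_map.1 hB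
    exact pFree_A i
  have right_s : Derivable H (R (Lg.bigFus (s.toList.map A)) + ∑ i ∈ s, k i) := by
    rw [← Finset.sum_map_toList]
    exact hD.bigFusR fun i _ => right_A i
  have sum_s : ((s.toList.map A).map L).sum = ∑ i, if c.m i ≠ 0 then L (A i) else 0 := by
    rw [List.map_map, Finset.sum_map_toList, Finset.sum_filter]
    rfl
  by_cases h0 : ∃ i₀, c.m i₀ = 0
  · obtain ⟨i₀, hi₀⟩ := h0
    refine ⟨_, Set.mem_biUnion ⟨Q, hQ, hinst⟩ (.inr ⟨_, hs, rfl⟩), ?_, ?_, ?_⟩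
    · exact Lg.fus.pFree₂ pFree_s Lg.top.pFree₀
    · rw [add_comm]
      refine hD.fusL (hD.bigFusL ?_)
      -- One `⊤` stands for all contexts without premises. It may be put into the context `i₀`,
      -- where nothing has to be proved.
      have := extend (fun i => (if c.m i ≠ 0 then L (A i) else 0) +
        if i = i₀ then L Lg.cTop else 0) fun i r => by
          have h1 : c.m i ≠ 0 := r.pos.ne'
          have h2 : i ≠ i₀ := fun h => h1 (h ▸ hi₀)
          simpa [h1, h2] using left_A i r
      rwa [Finset.sum_add_distrib, Finset.sum_ite_eq' Finset.univ i₀,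
        if_pos (Finset.mem_univ _), ← sum_s, add_assoc] at this
    -- The factor `⊤` absorbs the shares of `X` in all contexts without premises.
    · have := hD.fusR right_s (hD.topR (∑ i with ¬ c.m i ≠ 0, k i))
      rwa [Finset.sum_filter_add_sum_filter_not, hk, add_comm] at this
  · push Not at h0
    have hs' : s = Finset.univ := Finset.filter_true_of_mem fun i _ => h0 i
    refine ⟨_, Set.mem_biUnion ⟨Q, hQ, hinst⟩ (.inl ⟨_, hs, rfl⟩), pFree_s, ?_, ?_⟩
    · rw [add_comm]
      refine hD.bigFusL ?_
      rw [sum_s]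
      exact extend _ fun i r => by simpa [h0 i] using left_A i r
    · rw [hs', hk, add_comm] at right_s
      rwa [hs']

/-- If `S` lies within one context, no smaller sequent is available, but the premises over that
context are again `S` plus a `p`-free sequent, so `J` passes through the rule. Otherwise every share
of `S` is a proper subsequent, its interpolant is added to the corresponding context, and the rule
is reapplied. -/
theorem exists_finite_of_main_right (hD : CFLeClosed (Derivable H)) {S : Sequent Lg At}
    {I : Sequent Lg At → Formula Lg At}
    (hI : ∀ T : Sequent Lg At, T.ProperSub S → IsInterpolant H p T (I T)) :
    ∃ C : Set (Formula Lg At), C.Finite ∧ ∀ Q ∈ H, ∀ (c : ContextRule Q)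
      (ctx : Fin c.n → Sequent Lg At) (X X' : Sequent Lg At), X.Free p → X = c.main + X' →
      ∑ i, ctx i = S + X' → (∀ i r, Derivable H (ctx i + c.act i r)) →
      (∃ F ∈ C, Interpolates H p S X F) ∨
      ∀ J, (∀ i r Y, Y.Free p → ctx i + c.act i r = S + Y → Derivable H (Y + R J)) →
        Derivable H (X + R J) := by
  classical
  refine ⟨Lg.bigPlus '' {l | l.length ≤ S.card ∧ ∀ A ∈ l, A ∈ I '' {T | ∃ U, S = T + U}},
    (List.finite_setOf_length_le_forall_mem ((finite_setOf_add_eq S).image I) _).image _, ?_⟩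
  intro Q hQ c ctx X X' hX hX' hctx hprem
  obtain ⟨g, k, hgk, hg, hk⟩ := exists_refinement_sum hctx
  rw [hX', free_add, ← hk, free_sum] at hX
  have hfree : ∀ i r, (k i + c.act i r).Free p := fun i r =>
    free_add.2 ⟨hX.2 i (Finset.mem_univ i), c.free_act hX.1 i r⟩
  have hsplit : ∀ i, S = g i + ∑ j ∈ Finset.univ.erase i, g j := fun i => by
    rw [Finset.add_sum_erase _ _ (Finset.mem_univ i), hg]
  by_cases h : ∃ i₀, g i₀ = S
  · obtain ⟨i₀, hi₀⟩ := h
    have hzero : ∀ i, i ≠ i₀ → g i = 0 := fun i hi => by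
      have h1 := congrArg card (hsplit i₀)
      rw [hi₀, map_add, left_eq_add, map_sum, Finset.sum_eq_zero_iff] at h1
      exact card_eq_zero.1 (h1 i (by simp [hi]))
    refine .inr fun J hJ => ?_
    have := c.derivable hQ (ctx := fun i => k i + if i = i₀ then R J else 0) fun i r => by
      by_cases hi : i = i₀
      · subst hi
        have := hJ i r _ (hfree i r) (by rw [hgk, hi₀, add_assoc])
        simpa [add_right_comm] using this
      · have := hprem i r
        rw [hgk, hzero i hi, zero_add] at this
        simpa [hi] using this
    rwa [Finset.sum_add_distrib, Finset.sum_ite_eq' Finset.univ i₀,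
        if_pos (Finset.mem_univ _), hk, ← add_assoc, ← hX'] at this
  · push Not at h
    have hproper : ∀ i, (g i).ProperSub S := fun i => properSub_of_add (hsplit i) fun h0 =>
      h i (by have := hsplit i; rw [h0, add_zero] at this; exact this.symm)
    -- Only nonzero shares contribute a summand, which bounds the length of the sum by the size of
    -- `S`, whatever the number of contexts.
    let s : Finset (Fin c.n) := Finset.univ.filter fun i => g i ≠ 0
    refine .inl ⟨_, ⟨s.toList.map fun i => I (g i), ⟨?_, ?_⟩, rfl⟩, ?_, ?_, ?_⟩
    · rw [List.length_map, Finset.length_toList, ← hg, map_sum, Finset.card_eq_sum_ones]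
      refine (Finset.sum_le_sum fun i hi => ?_).trans
        (Finset.sum_le_sum_of_subset (Finset.subset_univ s))
      exact Nat.one_le_iff_ne_zero.2 (card_eq_zero.not.2 (Finset.mem_filter.1 hi).2)
    · intro B hB
      obtain ⟨i, -, rfl⟩ := List.mem_map.1 hB
      exact ⟨g i, ⟨_, hsplit i⟩, rfl⟩
    · refine pFree_bigPlus fun B hB => ?_
      obtain ⟨i, -, rfl⟩ := List.mem_map.1 hB
      exact (hI _ (hproper i)).pFree
    · have := hD.bigPlusL (l := s.toList) (A := fun i => I (g i)) (X := g) fun i _ => by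
        rw [add_comm]; exact (hI _ (hproper i)).left
      rwa [Finset.sum_map_toList, Finset.sum_filter_ne_zero, hg, add_comm] at this
    · rw [add_comm]
      refine hD.bigPlusR ?_
      have := c.derivable hQ (ctx := fun i => k i + if g i ≠ 0 then R (I (g i)) else 0)
        fun i r => by
          have h1 := hprem i r
          rw [hgk] at h1
          by_cases hi : g i = 0
          · simpa [hi] using h1
          · have := (hI _ (hproper i)).right _ (hfree i r) (by rwa [← add_assoc])
            simpa [hi, add_right_comm] using this
      rw [Finset.sum_add_distrib, ← Finset.sum_filter, hk, ← add_assoc, ← hX', add_comm] at this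
      rwa [List.map_map, Finset.sum_map_toList]

end Interpolants

/-! ### Interpolants for focused axioms -/

section Axioms

variable {Lg : Language.{u}} {At : Type v} {H : Calculus Lg At} {p : At}

theorem MetaFormula.vars_inst_congr {A B : MetaFormula Lg At} (h : A.vars = B.vars)
    (σ : ℕ → Formula Lg At) : (A.inst σ).vars = (B.inst σ).vars :=
  (vars_inst_subset h.le σ).antisymm (vars_inst_subset h.ge σ)

theorem SameVars.pFree_inst {M : Multiset (MetaFormula Lg At)} (hM : SameVars M)
    (σ : ℕ → Formula Lg At) {A B : Formula Lg At} (hA : A ∈ M.map (MetaFormula.inst σ))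
    (hB : B ∈ M.map (MetaFormula.inst σ)) (h : PFree p A) : PFree p B := by
  obtain ⟨A', hA', rfl⟩ := Multiset.mem_map.1 hA
  obtain ⟨B', hB', rfl⟩ := Multiset.mem_map.1 hB
  exact pFree_of_vars_subset (MetaFormula.vars_inst_congr (hM B' hB' A' hA') σ).le h

theorem eq_zero_of_pFree_imp {a b M : Multiset (Formula Lg At)} (hM : M = a + b)
    (h : ∀ A ∈ M, ∀ B ∈ M, PFree p A → PFree p B) (ha : ¬ MPFree p a) (hb : MPFree p b) :
    b = 0 := by
  refine Multiset.eq_zero_of_forall_notMem fun B hB => ha fun A hA => ?_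
  exact h B (by simp [hM, hB]) A (by simp [hM, hA]) (hb B hB)

theorem Sequent.eq_zero_of_pFree_imp {S X U : Sequent Lg At} (hU : U = S + X)
    (h : ∀ A ∈ U.ant + U.suc, ∀ B ∈ U.ant + U.suc, PFree p A → PFree p B) (hS : ¬ S.Free p)
    (hX : X.Free p) : X = 0 := by
  have h0 := SeqCalc.eq_zero_of_pFree_imp (p := p) (a := S.ant + S.suc) (b := X.ant + X.suc)
    (by rw [hU, ant_add, suc_add, add_add_add_comm]) h
    (fun hf => hS ⟨fun A hA => hf A (by simp [hA]), fun A hA => hf A (by simp [hA])⟩)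
    (fun A hA => (Multiset.mem_add.1 hA).elim (hX.1 A) (hX.2 A))
  rw [add_eq_zero] at h0
  exact Sequent.ext h0.1 h0.2

/-- Let `a` be the part of `M` inside `S`. If `a` is `p`-free, `∗a → ⊥` works: `⊥` absorbs the rest
of `S`, and on the other side `a` is returned to complete the axiom. If not, no formula of `M` lies
in `X`, so `S` alone contains the axiom and `⊤` works. -/
theorem exists_interpolates_of_left (hD : CFLeClosed (Derivable H)) {S X : Sequent Lg At}
    {M : Multiset (Formula Lg At)} (hMD : ∀ Y, Derivable H (⟨M, 0⟩ + Y))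
    (hM : ∀ A ∈ M, ∀ B ∈ M, PFree p A → PFree p B) (hX : X.Free p) {Y : Sequent Lg At}
    (hSX : S + X = ⟨M, 0⟩ + Y) :
    Interpolates H p S X Lg.cTop ∨
      ∃ a ≤ S.ant, Interpolates H p S X (Lg.cImp (Lg.bigFus a.toList) Lg.cBot) := by
  obtain ⟨a₁, a₂, S', X', hM', -, rfl, rfl⟩ := exists_refinement hSX.symm
  obtain ⟨a, a'⟩ := a₁
  obtain ⟨b, b'⟩ := a₂
  rw [mk_add_mk, Sequent.mk.injEq] at hM'
  obtain ⟨rfl, h0⟩ := hM'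
  obtain ⟨rfl, rfl⟩ := add_eq_zero.1 h0.symm
  rw [free_add] at hX
  by_cases ha : MPFree p a
  · refine .inr ⟨a, by simp, ?_, ?_, ?_⟩
    · exact Lg.imp.pFree₂ (pFree_bigFus fun A hA => ha A (by simpa using hA)) Lg.bot.pFree₀
    · have := hD.impL (hD.bigFusR_self a.toList) (hD.botL S')
      rwa [sum_map_L, Multiset.coe_toList, add_comm] at this
    · rw [add_comm]
      refine hD.impR (hD.bigFusL ?_)
      rw [sum_map_L, Multiset.coe_toList]
      convert hMD (R Lg.cBot + X') using 1
      rw [add_left_comm (R _), ← add_assoc, mk_add_mk]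
      rfl
  · obtain rfl := eq_zero_of_pFree_imp rfl hM ha hX.1.1
    refine .inl ⟨Lg.top.pFree₀, ?_, by rw [add_comm]; exact hD.topR _⟩
    rw [add_zero] at hMD
    rw [add_assoc]
    exact hMD _

/-- The mirror image, with `+a + ⊥` in place of `∗a → ⊥`; the summand `⊥` again absorbs the rest of
`S`. -/
theorem exists_interpolates_of_right (hD : CFLeClosed (Derivable H)) {S X : Sequent Lg At}
    {M : Multiset (Formula Lg At)} (hMD : ∀ Y, Derivable H (⟨0, M⟩ + Y))
    (hM : ∀ A ∈ M, ∀ B ∈ M, PFree p A → PFree p B) (hX : X.Free p) {Y : Sequent Lg At}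
    (hSX : S + X = ⟨0, M⟩ + Y) :
    Interpolates H p S X Lg.cTop ∨
      ∃ a ≤ S.suc, Interpolates H p S X (Lg.cPlus (Lg.bigPlus a.toList) Lg.cBot) := by
  obtain ⟨a₁, a₂, S', X', hM', -, rfl, rfl⟩ := exists_refinement hSX.symm
  obtain ⟨a', a⟩ := a₁
  obtain ⟨b', b⟩ := a₂
  rw [mk_add_mk, Sequent.mk.injEq] at hM'
  obtain ⟨h0, rfl⟩ := hM'
  obtain ⟨rfl, rfl⟩ := add_eq_zero.1 h0.symm
  rw [free_add] at hX
  by_cases ha : MPFree p a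
  · refine .inr ⟨a, by simp, ?_, ?_, ?_⟩
    · exact Lg.plus.pFree₂ (pFree_bigPlus fun A hA => ha A (by simpa using hA)) Lg.bot.pFree₀
    · have := hD.plusL (hD.bigPlusL_self a.toList) (hD.botL S')
      rwa [sum_map_R, Multiset.coe_toList, add_comm] at this
    · rw [add_comm]
      refine hD.plusR (hD.bigPlusR ?_)
      rw [sum_map_R, Multiset.coe_toList]
      convert hMD (R Lg.cBot + X') using 1
      rw [add_left_comm (R _), ← add_assoc, mk_add_mk]
      rfl
  · obtain rfl := eq_zero_of_pFree_imp rfl hM ha hX.1.2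
    refine .inl ⟨Lg.top.pFree₀, ?_, by rw [add_comm]; exact hD.topR _⟩
    rw [add_zero] at hMD
    rw [add_assoc]
    exact hMD _

/-- Without contexts, one formula containing `p` forces `p` into all of them. Hence `X` is empty,
`S` is itself an axiom, and `1` interpolates. -/
theorem exists_finite_of_axiom (hD : CFLeClosed (Derivable H)) {S : Sequent Lg At}
    (hS : ¬ S.Free p) :
    ∃ C : Set (Formula Lg At), C.Finite ∧ ∀ Q ∈ H, IsFocusedAxiom Q → ∀ P, ∀ X : Sequent Lg At,
      X.Free p → Q.Inst P (S + X) → ∃ F ∈ C, Interpolates H p S X F := by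
  classical
  refine ⟨{Lg.cOne, Lg.cTop} ∪
    ((fun a : Multiset _ => Lg.cImp (Lg.bigFus a.toList) Lg.cBot) '' Set.Iic S.ant ∪
      (fun a : Multiset _ => Lg.cPlus (Lg.bigPlus a.toList) Lg.cBot) '' Set.Iic S.suc),
    (Set.toFinite _).union (((Set.finite_Iic _).image _).union ((Set.finite_Iic _).image _)), ?_⟩
  intro Q hQ hax P X hX hinst
  have one : Q.Inst 0 (S + X) → X = 0 → Interpolates H p S X Lg.cOne := by
    rintro h rfl
    refine ⟨Lg.one.pFree₀, ?_, ?_⟩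
    · rw [add_comm]
      exact hD.oneL (.step Q 0 S hQ (by simpa using h) (by simp))
    · rw [zero_add]
      exact hD.oneR
  cases hax with
  | identity φ =>
    obtain ⟨σ, τ, rfl, h⟩ := hinst
    refine ⟨_, .inl (.inl rfl), one ⟨σ, τ, rfl, h⟩ (Sequent.eq_zero_of_pFree_imp rfl ?_ hS hX)⟩
    rw [h]
    simp +contextual [inst_mseq]
  | freeRight α hα =>
    obtain ⟨σ, τ, rfl, h⟩ := hinst
    refine ⟨_, .inl (.inl rfl), one ⟨σ, τ, rfl, h⟩ (Sequent.eq_zero_of_pFree_imp rfl ?_ hS hX)⟩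
    rw [h]
    intro A hA B hB
    exact hα.pFree_inst σ (by simpa [inst_mseq] using hA) (by simpa [inst_mseq] using hB)
  | freeLeft β hβ =>
    obtain ⟨σ, τ, rfl, h⟩ := hinst
    refine ⟨_, .inl (.inl rfl), one ⟨σ, τ, rfl, h⟩ (Sequent.eq_zero_of_pFree_imp rfl ?_ hS hX)⟩
    rw [h]
    intro A hA B hB
    exact hβ.pFree_inst σ (by simpa [inst_mseq] using hA) (by simpa [inst_mseq] using hB)
  | ctxLeft φ Γ Δ hc hφ =>
    obtain ⟨σ, τ, rfl, h⟩ := hinst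
    have hMD : ∀ Y, Derivable H (⟨φ.map (MetaFormula.inst σ), 0⟩ + Y) := fun Y => by
      refine .step _ 0 _ hQ ⟨σ, fun n => if n = Γ then Y.ant else Y.suc, rfl, ?_⟩ (by simp)
      simp [inst_mseq, add_def, hc.symm]
    rcases exists_interpolates_of_left hD hMD (fun A hA B hB => hφ.pFree_inst σ hA hB) hX
      (Y := ⟨τ Γ, τ Δ⟩) (h.trans (by simp [inst_mseq, mk_add_mk])) with h | ⟨a, ha, h⟩
    · exact ⟨_, .inl (.inr rfl), h⟩
    · exact ⟨_, .inr (.inl ⟨a, ha, rfl⟩), h⟩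
  | ctxRight φ Γ Δ hc hφ =>
    obtain ⟨σ, τ, rfl, h⟩ := hinst
    have hMD : ∀ Y, Derivable H (⟨0, φ.map (MetaFormula.inst σ)⟩ + Y) := fun Y => by
      refine .step _ 0 _ hQ ⟨σ, fun n => if n = Γ then Y.ant else Y.suc, rfl, ?_⟩ (by simp)
      simp [inst_mseq, add_def, hc.symm]
    rcases exists_interpolates_of_right hD hMD (fun A hA B hB => hφ.pFree_inst σ hA hB) hX
      (Y := ⟨τ Γ, τ Δ⟩) (h.trans (by simp [inst_mseq, mk_add_mk])) with h | ⟨a, ha, h⟩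
    · exact ⟨_, .inl (.inr rfl), h⟩
    · exact ⟨_, .inr (.inr ⟨a, ha, rfl⟩), h⟩

end Axioms

/-! ### Interpolants for the modal rules -/

section Modal

variable {Lg : Language.{u}} {At : Type v} {H : Calculus Lg At} {p : At}

/-- Boxing all formulas of a sequent. -/
def Sequent.box (b : {c : Lg.Conn // Lg.arity c = 1}) (S : Sequent Lg At) : Sequent Lg At :=
  ⟨S.ant.map (Lg.cBox b), S.suc.map (Lg.cBox b)⟩

theorem Sequent.box_add (b : {c : Lg.Conn // Lg.arity c = 1}) (S T : Sequent Lg At) :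
    (S + T).box b = S.box b + T.box b := by
  ext1 <;> simp [box]

theorem Sequent.box_L (b : {c : Lg.Conn // Lg.arity c = 1}) (A : Formula Lg At) :
    (L A).box b = L (Lg.cBox b A) := rfl

theorem Sequent.box_R (b : {c : Lg.Conn // Lg.arity c = 1}) (A : Formula Lg At) :
    (R A).box b = R (Lg.cBox b A) := rfl

theorem Sequent.box_injective (b : {c : Lg.Conn // Lg.arity c = 1}) :
    Function.Injective (Sequent.box b : Sequent Lg At → Sequent Lg At) := fun _ _ h =>
  Sequent.ext (Multiset.map_injective (cBox_injective b) (congrArg ant h))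
    (Multiset.map_injective (cBox_injective b) (congrArg suc h))

theorem Sequent.free_of_box {b : {c : Lg.Conn // Lg.arity c = 1}} {S : Sequent Lg At}
    (h : (S.box b).Free p) : S.Free p :=
  ⟨fun _ hA => (pFree_cBox b).1 (h.1 _ (Multiset.mem_map_of_mem _ hA)),
    fun _ hA => (pFree_cBox b).1 (h.2 _ (Multiset.mem_map_of_mem _ hA))⟩

theorem _root_.Multiset.exists_map_eq_of_map_eq_add {α β : Type*} {f : α → β} {s : Multiset α}
    {a b : Multiset β} (hf : Function.Injective f) (h : s.map f = a + b) :
    ∃ a' b', a = a'.map f ∧ b = b'.map f ∧ s = a' + b' := by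
  have lift : ∀ c : Multiset β, c ≤ s.map f → ∃ c' : Multiset α, c = c'.map f := fun c hc => by
    induction c using Multiset.induction with
    | empty => exact ⟨0, rfl⟩
    | cons x c ih =>
      obtain ⟨c', rfl⟩ := ih ((Multiset.le_cons_self _ _).trans hc)
      obtain ⟨y, -, rfl⟩ := Multiset.mem_map.1 (Multiset.mem_of_le hc (Multiset.mem_cons_self x _))
      exact ⟨y ::ₘ c', by simp⟩
  obtain ⟨a', rfl⟩ := lift a (by simp [h])
  obtain ⟨b', rfl⟩ := lift b (by simp [h])
  rw [← Multiset.map_add] at h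
  exact ⟨a', b', rfl, rfl, Multiset.map_injective hf h⟩

theorem Sequent.exists_box_eq_of_add_eq_box {b : {c : Lg.Conn // Lg.arity c = 1}}
    {S X T : Sequent Lg At} (h : S + X = T.box b) :
    ∃ S' X', S = S'.box b ∧ X = X'.box b ∧ T = S' + X' := by
  obtain ⟨a, c, h₁, h₂, h₃⟩ :=
    Multiset.exists_map_eq_of_map_eq_add (cBox_injective b) (congrArg ant h).symm
  obtain ⟨a', c', h₁', h₂', h₃'⟩ :=
    Multiset.exists_map_eq_of_map_eq_add (cBox_injective b) (congrArg suc h).symm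
  exact ⟨⟨a, a'⟩, ⟨c, c'⟩, Sequent.ext h₁ h₁', Sequent.ext h₂ h₂', Sequent.ext h₃ h₃'⟩

theorem IsInterpolant.dual_left (hD : CFLeClosed (Derivable H)) {S : Sequent Lg At}
    {I : Formula Lg At} (h : IsInterpolant H p S I) :
    Derivable H (S + R (Lg.cImp I Lg.cZero)) := by
  rw [add_comm]
  refine hD.impR ?_
  rw [add_left_comm]
  refine hD.zeroR ?_
  rw [add_comm]
  exact h.left

theorem IsInterpolant.dual_right (hD : CFLeClosed (Derivable H)) {S : Sequent Lg At}
    {I : Formula Lg At} (h : IsInterpolant H p S I) {X : Sequent Lg At} (hX : X.Free p)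
    (hSX : Derivable H (S + X)) : Derivable H (X + L (Lg.cImp I Lg.cZero)) := by
  have h1 := h.right X hX hSX
  rw [add_comm] at h1
  have := hD.impL h1 (Y := 0) (by rw [add_zero]; exact hD.zeroL)
  rwa [add_zero, add_comm] at this

/-- `K` boxes only sequents with exactly one succedent formula. If that formula is in `S`, both `S,
I ⇒` and `X ⇒ I` have this shape. If it is in `X`, the sequents `S ⇒ I → 0` and `X, I → 0 ⇒` do, and
the negation is undone after boxing. -/
theorem exists_interpolates_of_box (hD : CFLeClosed (Derivable H))
    {b : {c : Lg.Conn // Lg.arity c = 1}}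
    (hK : ∀ T : Sequent Lg At, T.suc.card = 1 → Derivable H T → Derivable H (T.box b))
    {S X : Sequent Lg At} {I : Formula Lg At} (hI : IsInterpolant H p S I) (hX : X.Free p)
    (hSX : Derivable H (S + X)) (hcard : (S + X).suc.card = 1) :
    Interpolates H p (S.box b) (X.box b) (Lg.cBox b I) ∨
      Interpolates H p (S.box b) (X.box b)
        (Lg.cImp (Lg.cBox b (Lg.cImp I Lg.cZero)) Lg.cZero) := by
  rw [suc_add, Multiset.card_add] at hcard
  rcases Nat.eq_zero_or_pos X.suc.card with h0 | h1
  · refine .inl ⟨(pFree_cBox b).2 hI.pFree, ?_, ?_⟩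
    · rw [← box_L, ← box_add]
      refine hK _ ?_ hI.left
      rw [suc_add, Multiset.card_add]
      simp only [L, Multiset.card_zero]
      omega
    · rw [← box_R, ← box_add]
      refine hK _ ?_ (hI.right X hX hSX)
      rw [suc_add, Multiset.card_add]
      simp only [R, Multiset.card_singleton]
      omega
  · refine .inr ⟨?_, ?_, ?_⟩
    · exact Lg.imp.pFree₂ ((pFree_cBox b).2 (Lg.imp.pFree₂ hI.pFree Lg.zero.pFree₀))
        Lg.zero.pFree₀
    · have h : Derivable H (R (Lg.cBox b (Lg.cImp I Lg.cZero)) + S.box b) := by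
        rw [add_comm, ← box_R, ← box_add]
        refine hK _ ?_ (hI.dual_left hD)
        rw [suc_add, Multiset.card_add]
        simp only [R, Multiset.card_singleton]
        omega
      have := hD.impL h (Y := 0) (by rw [add_zero]; exact hD.zeroL)
      rwa [add_zero, add_comm] at this
    · rw [add_comm]
      refine hD.impR ?_
      rw [add_left_comm]
      refine hD.zeroR ?_
      rw [add_comm, ← box_L, ← box_add]
      refine hK _ ?_ (hI.dual_right hD hX hSX)
      rw [suc_add, Multiset.card_add]
      simp only [L, Multiset.card_zero]
      omega

theorem exists_finite_of_modal (hD : CFLeClosed (Derivable H)) (hDK : .modalD ∈ H → .modalK ∈ H)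
    {S : Sequent Lg At} (hS : S ≠ 0) {I : Sequent Lg At → Formula Lg At}
    (hI : ∀ b, Lg.box = some b → ∀ T : Sequent Lg At, S = T.box b →
      IsInterpolant H p T (I T)) :
    ∃ C : Set (Formula Lg At), C.Finite ∧ ∀ Q ∈ H, Q = .modalK ∨ Q = .modalD → ∀ P,
      ∀ X : Sequent Lg At, X.Free p → Q.Inst P (S + X) → (∀ T ∈ P, Derivable H T) →
      ∃ F ∈ C, Interpolates H p S X F := by
  rcases hb : Lg.box with _ | b
  · refine ⟨∅, Set.finite_empty, ?_⟩
    rintro Q hQ (rfl | rfl) P X - ⟨b, hb', -⟩ <;> simp [hb] at hb'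
  -- Boxing is injective, so there is at most one way to unbox `S`.
  have hfin : {T : Sequent Lg At | S = T.box b}.Finite :=
    Set.Subsingleton.finite fun T hT U hU => box_injective b (hT.symm.trans hU)
  have hK : Rule.modalK ∈ H → ∀ T : Sequent Lg At, T.suc.card = 1 → Derivable H T →
      Derivable H (T.box b) := by
    intro hmem ⟨Γ, Δ⟩ hT h
    obtain ⟨A, rfl⟩ := Multiset.card_eq_one.1 hT
    exact .step _ _ _ hmem ⟨b, hb, Γ, A, rfl, rfl⟩ (by simpa using h)
  refine ⟨(fun T => Lg.cBox b (I T)) '' {T | S = T.box b} ∪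
    (fun T => Lg.cImp (Lg.cBox b (Lg.cImp (I T) Lg.cZero)) Lg.cZero) '' {T | S = T.box b},
    (hfin.image _).union (hfin.image _), ?_⟩
  rintro Q hQ (rfl | rfl) P X hX ⟨b', hb', hinst⟩ hP
  · obtain rfl : b = b' := by simpa [hb] using hb'
    obtain ⟨Γ, A, rfl, hSX⟩ := hinst
    obtain ⟨S', X', rfl, rfl, hT⟩ := exists_box_eq_of_add_eq_box (b := b) (T := ⟨Γ, {A}⟩)
      (hSX.trans (by simp [box]))
    rcases exists_interpolates_of_box hD (hK hQ) (hI b hb S' rfl) (free_of_box hX)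
      (hT ▸ hP _ (by simp)) (by rw [← hT]; rfl) with h | h
    · exact ⟨_, .inl ⟨S', rfl, rfl⟩, h⟩
    · exact ⟨_, .inr ⟨S', rfl, rfl⟩, h⟩
  · obtain rfl : b = b' := by simpa [hb] using hb'
    obtain ⟨Γ, -, rfl, hSX⟩ := hinst
    obtain ⟨S', X', rfl, rfl, hT⟩ := exists_box_eq_of_add_eq_box (b := b) (T := ⟨Γ, 0⟩)
      (hSX.trans (by simp [box]))
    have hI := hI b hb S' rfl
    have hsuc : S'.suc = 0 ∧ X'.suc = 0 := add_eq_zero.1 (congrArg suc hT).symm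
    refine ⟨_, .inl ⟨S', rfl, rfl⟩, (pFree_cBox b).2 hI.pFree, ?_, ?_⟩
    -- The interpolant itself makes the context of `D` nonempty.
    · refine .step _ {S' + L (I S')} _ hQ ⟨b, hb, (S' + L (I S')).ant, by simp [L], ?_, ?_⟩
        (by simpa using hI.left)
      · simp [add_def, hsuc.1, L]
      · simp [add_def, hsuc.1, L, box]
    · rw [← box_R, ← box_add]
      -- The interpolant enters an empty succedent here, so `K` is required in place of `D`.
      refine hK (hDK hQ) _ (by simp [hsuc.2, R]) (hI.right X' (free_of_box hX) ?_)
      rw [← hT]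
      exact hP _ (by simp)

end Modal

/-! ### Assembly of the interpolants and uniform interpolation -/

section UniformInterpolation

variable {Lg : Language.{u}} {At : Type v} {H : Calculus Lg At}

/-- The second alternative is stated for every `J` because the disjunction it is applied to becomes
available only after all candidates have been collected. -/
theorem exists_isInterpolant_of_finite {p : At} (hD : CFLeClosed (Derivable H))
    {S : Sequent Lg At} {C : Set (Formula Lg At)} (hC : C.Finite)
    (h : ∀ Q ∈ H, ∀ P, ∀ X : Sequent Lg At, X.Free p → Q.Inst P (S + X) →
      (∀ T ∈ P, Derivable H T) → (∃ F ∈ C, Interpolates H p S X F) ∨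
        ∀ J, (∀ T ∈ P, ∀ Y : Sequent Lg At, Y.Free p → T = S + Y → Derivable H (Y + R J)) →
          Derivable H (X + R J)) :
    ∃ I, IsInterpolant H p S I := by
  -- Candidates that contain `p` or fail on the side of `S` are discarded, so `C` need only be
  -- finite and large enough.
  obtain ⟨l, hl⟩ := (hC.subset
    (Set.sep_subset C fun F => PFree p F ∧ Derivable H (S + L F))).exists_finset_coe
  have mem_l : ∀ F, F ∈ l.toList ↔ F ∈ C ∧ PFree p F ∧ Derivable H (S + L F) := fun F => by
    rw [Finset.mem_toList, ← Finset.mem_coe, hl]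
    rfl
  refine ⟨Lg.bigDisj l.toList, ?_, ?_, ?_⟩
  · exact pFree_bigDisj fun F hF => ((mem_l F).1 hF).2.1
  · rw [add_comm]
    exact hD.bigDisjL fun F hF => by rw [add_comm]; exact ((mem_l F).1 hF).2.2
  -- `S` stays fixed while `X` varies along the derivation.
  · suffices ∀ U, Derivable H U → ∀ X : Sequent Lg At, X.Free p → U = S + X →
        Derivable H (X + R (Lg.bigDisj l.toList)) from fun X hX hSX => this _ hSX X hX rfl
    intro U hU
    induction hU with
    | step Q P U hQ hinst hP ih =>
      rintro X hX rfl
      rcases h Q hQ P X hX hinst hP with ⟨F, hF, hF'⟩ | h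
      · rw [add_comm]
        refine hD.bigDisjR ((mem_l F).2 ⟨hF, hF'.pFree, hF'.left⟩) ?_
        rw [add_comm]
        exact hF'.right
      · exact h _ ih

theorem exists_isInterpolant (hD : CFLeClosed (Derivable H)) (hterm : Terminating H)
    (hsem : ConsistsOfSemiAnalytic H) (p : At) (S : Sequent Lg At) :
    ∃ I, IsInterpolant H p S I := by
  obtain ⟨hfin, lt, hwf, hprem, hsub, hbox⟩ := hterm
  induction S using hwf.induction with
  | _ S ih =>
  by_cases hS : S.Free p
  · exact exists_interpolant_of_free hD hS
  have hS0 : S ≠ 0 := fun h => hS (h ▸ free_zero)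
  -- `choose!` needs a default value for sequents that are not below `S`.
  have : Nonempty (Formula Lg At) := ⟨Lg.cOne⟩
  choose! I hI using ih
  obtain ⟨C₁, hC₁, h₁⟩ := exists_finite_of_axiom (H := H) hD hS
  obtain ⟨C₂, hC₂, h₂⟩ := exists_finite_of_main_left (p := p) hD (hfin S)
    fun Q hQ P hP T hT => hI T (hprem Q hQ P S hP T hT)
  obtain ⟨C₃, hC₃, h₃⟩ := exists_finite_of_main_right (p := p) hD
    fun T hT => hI T (hsub S T hT)
  obtain ⟨C₄, hC₄, h₄⟩ := exists_finite_of_modal (p := p) hD hsem.2 hS0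
    fun b hb T hT => hI T (by
      -- Taking both unboxed contexts empty gives `T` below `T.box b`. The order requires `T ≠ 0`,
      -- which holds since `S ≠ 0`.
      have := hbox b hb 0 T.ant 0 T.suc fun h => hS0 (by
        obtain ⟨h₁, h₂⟩ := add_eq_zero.1 h
        rw [hT, Sequent.box, h₁, h₂]
        rfl)
      simp only [zero_add] at this
      rw [hT]
      exact this)
  refine exists_isInterpolant_of_finite hD (((hC₁.union hC₂).union hC₃).union hC₄) ?_
  intro Q hQ P X hX hinst hP
  have context : ((∃ d : SemiAnalyticData Lg At, Q = d.leftRule) ∨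
      ∃ d : SemiAnalyticData Lg At, Q = d.rightRule) →
      (∃ F ∈ C₁ ∪ C₂ ∪ C₃ ∪ C₄, Interpolates H p S X F) ∨
        ∀ J, (∀ T ∈ P, ∀ Y : Sequent Lg At, Y.Free p → T = S + Y → Derivable H (Y + R J)) →
          Derivable H (X + R J) := by
    intro h
    obtain ⟨c, ctx, rfl, hSX⟩ := exists_contextRule h hinst
    have hprem' : ∀ i r, Derivable H (ctx i + c.act i r) := fun i r =>
      hP _ (mem_sum_sum_singleton.2 ⟨i, r, rfl⟩)
    rcases split_main c.card_main hSX with ⟨S', hS', hctx⟩ | ⟨X', hX', hctx⟩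
    · obtain ⟨F, hF, hF'⟩ := h₂ Q hQ c ctx S' X hX hS' hctx hprem'
      exact .inl ⟨F, .inl (.inl (.inr hF)), hF'⟩
    · rcases h₃ Q hQ c ctx X X' hX hX' hctx hprem' with ⟨F, hF, hF'⟩ | h
      · exact .inl ⟨F, .inl (.inr hF), hF'⟩
      · exact .inr fun J hJ => h J fun i r Y hY hT =>
          hJ _ (mem_sum_sum_singleton.2 ⟨i, r, rfl⟩) Y hY hT
  rcases hsem.1 Q hQ with hax | hl | hr | hmod
  · obtain ⟨F, hF, hF'⟩ := h₁ Q hQ hax P X hX hinst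
    exact .inl ⟨F, .inl (.inl (.inl hF)), hF'⟩
  · exact context (.inl hl)
  · exact context (.inr hr)
  · obtain ⟨F, hF, hF'⟩ := h₄ Q hQ hmod P X hX hinst hP
    exact .inl ⟨F, .inr hF, hF'⟩

theorem strongUniformInterpolation (hD : CFLeClosed (Derivable H)) (hterm : Terminating H)
    (hsem : ConsistsOfSemiAnalytic H) : StrongUniformInterpolation H H := by
  intro S p
  obtain ⟨I, hI⟩ := exists_isInterpolant hD hterm hsem p S
  refine ⟨I, Lg.cImp I Lg.cZero, hI.pFree, Lg.imp.pFree₂ hI.pFree Lg.zero.pFree₀, hI.left,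
    fun Γ Δ hΓ hΔ h => ?_, hI.dual_left hD, fun Γ Δ hΓ hΔ h => ?_⟩
  · have := hI.right ⟨Γ, Δ⟩ ⟨hΓ, hΔ⟩ h
    rwa [R, mk_add_mk, add_zero, add_comm Δ] at this
  · have := hI.dual_right hD (X := ⟨Γ, Δ⟩) ⟨hΓ, hΔ⟩ h
    rwa [L, mk_add_mk, add_zero, add_comm Γ] at this

theorem IsCalculusFor.derivable_singleton_iff {T : Logic Lg At} (hH : IsCalculusFor H T)
    (A B : Formula Lg At) : Derivable H ⟨{A}, {B}⟩ ↔ Lg.cImp A B ∈ T.thms := by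
  simpa [Language.bigFus, Language.bigPlus] using hH [A] [B]

/-- The left interpolant of `⇒ A` is `∀p A`, and the right interpolant of `A ⇒` is `∃p A`. -/
theorem StrongUniformInterpolation.uniformInterpolation {T : Logic Lg At}
    (hH : IsCalculusFor H T) (h : StrongUniformInterpolation H H) : T.UniformInterpolation := by
  intro A p
  obtain ⟨I, -, hI, -, hI₁, hI₂, -, -⟩ := h ⟨0, {A}⟩ p
  obtain ⟨-, J, -, hJ, -, -, hJ₁, hJ₂⟩ := h ⟨{A}, 0⟩ p
  refine ⟨I, J, hI, hJ, ?_, fun B hB hBA => ?_, ?_, fun B hB hAB => ?_⟩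
  · simpa [Sequent.mul, hH.derivable_singleton_iff] using hI₁
  · rw [← hH.derivable_singleton_iff] at hBA ⊢
    simpa using hI₂ {B} 0 (by simpa [MPFree] using hB) (by simp [MPFree])
      (by simpa [Sequent.mul] using hBA)
  · simpa [Sequent.mul, hH.derivable_singleton_iff] using hJ₁
  · rw [← hH.derivable_singleton_iff] at hAB ⊢
    simpa using hJ₂ 0 {B} (by simp [MPFree]) (by simpa [MPFree] using hB)
      (by simpa [Sequent.mul] using hAB)

end UniformInterpolation

end SeqCalc

theorem mainTheorem5 {Lg : SeqCalc.Language.{u}} {At : Type v}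
    (L : SeqCalc.Logic Lg At) (hL : L.ExtendsCFLe)
    (H : SeqCalc.Calculus Lg At) (hH : SeqCalc.IsCalculusFor H L)
    (hterm : SeqCalc.Terminating H) (hsem : SeqCalc.ConsistsOfSemiAnalytic H) :
    SeqCalc.StrongUniformInterpolation H H ∧ L.UniformInterpolation := by
  have h := SeqCalc.strongUniformInterpolation (hH.cFLeClosed hL) hterm hsem
  exact ⟨h, h.uniformInterpolation hH⟩
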